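/- Let $k$ be any field, $R=k[[s^2,s^3]]\subset S=k[[s]]$ and $\mathfrak m=(s^2,s^3)R$. For finitely generated $R$-modules $M,N$ say that $M$ \emph{degenerates} to $N$ if there are a discrete valuation ring $(V,tV,k)$ that is a $k$-algebra with residue field $k$ and a finitely generated $R\otimes_kV$-module $Q$, flat over $V$, with $Q/tQ\cong N$ as $R$-modules and $Q[1/t]\cong M\otimes_kV[1/t]$ as $R\otimes_kV[1/t]$-modules. A finitely generated module $M$ over a commutative Gorenstein ring $A$ is \emph{Cohen--Macaulay} if $\operatorname{Ext}^i_A(M,A)=0$ for all $i>0$; $\underline{\mathrm{CM}}(A)$ denotes the triangulated stable category of Cohen--Macaulay $A$-modules (morphisms modulo those factoring through a projective module). With $V=k[t]_{(t)}$ and $K=k(t)$, a module $M\in\underline{\mathrm{CM}}(R)$ \emph{stably degenerates} to $N\in\underline{\mathrm{CM}}(R)$ if there is a Cohen--Macaulay $R\otimes_kV$-module $Q$ with $Q\otimes_VK\cong M\otimes_kK$ in $\underline{\mathrm{CM}}(R\otimes_kK)$ and $Q/tQ\cong N$ in $\underline{\mathrm{CM}}(R)$. Then, for all natural numbers $m,n$,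 the module $R^m$ does not degenerate to $R^n\oplus\mathfrak m$. Moreover, $R$ is a Gorenstein local ring of Krull dimension one with maximal ideal $\mathfrak m$ and residue field $k$, and for the pair $(M,N)=(0,\mathfrak m)$ of Cohen--Macaulay $R$-modules: (2) there are a Cohen--Macaulay $R$-module $Z$ and a triangle $Z\xrightarrow{\binom{\varphi}{\psi}}M\oplus Z\to N\to Z[1]$ in $\underline{\mathrm{CM}}(R)$ such that $\psi$ is a nilpotent element of the stable endomorphism ring of $Z$; (3) $M$ stably degenerates to $N$; but (1) there are no natural numbers $m,n$ such that $R^m\oplus M$ degenerates to $R^n\oplus N$. In particular neither (2) nor (3) implies (1) in dimension one. -/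

import Mathlib

open CategoryTheory TensorProduct

universe u

noncomputable section

/-! ### Cohen-Macaulay modules and the stable category -/

/-- A finitely generated module `M` over a commutative (Gorenstein) ring `A` is Cohen-Macaulay
if `Ext_A^i(M, A) = 0` for all `i > 0`. -/
def IsCM {A : Type u} [CommRing A] (M : ModuleCat.{u} A) : Prop :=
  Module.Finite A M ∧ ∀ i : ℕ, 0 < i → Subsingleton (Abelian.Ext M (ModuleCat.of A A) i)

/-- A noetherian local ring is Gorenstein if it has finite injective dimension over itself. -/
def IsGorensteinLocal (A : Type u) [CommRing A] : Prop :=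
  IsNoetherianRing A ∧ IsLocalRing A ∧ ∃ n : ℕ, HasInjectiveDimensionLE (ModuleCat.of A A) n

/-- `f` factors through a projective `A`-module. -/
def FactorsThroughProjective {A : Type u} [CommRing A] {X Y : ModuleCat.{u} A} (f : X ⟶ Y) :
    Prop :=
  ∃ (P : ModuleCat.{u} A) (a : X ⟶ P) (b : P ⟶ Y), Module.Projective A P ∧ a ≫ b = f

/-- Two homomorphisms are identified stably if their difference factors through a projective. -/
def stableRel (A : Type u) [CommRing A] : HomRel (ModuleCat.{u} A) :=
  fun _ _ f g => FactorsThroughProjective (f - g)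

theorem FactorsThroughProjective.add {A : Type u} [CommRing A] {X Y : ModuleCat.{u} A}
    {f g : X ⟶ Y} (hf : FactorsThroughProjective f) (hg : FactorsThroughProjective g) :
    FactorsThroughProjective (f + g) := by
  obtain ⟨P, a, b, hP, rfl⟩ := hf
  obtain ⟨Q, c, d, hQ, rfl⟩ := hg
  refine ⟨ModuleCat.of A (P × Q), ModuleCat.ofHom (a.hom.prod c.hom),
    ModuleCat.ofHom (b.hom.coprod d.hom), inferInstanceAs (Module.Projective A (P × Q)), ?_⟩
  ext x
  simp

theorem FactorsThroughProjective.neg {A : Type u} [CommRing A] {X Y : ModuleCat.{u} A}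
    {f : X ⟶ Y} (hf : FactorsThroughProjective f) : FactorsThroughProjective (-f) := by
  obtain ⟨P, a, b, hP, rfl⟩ := hf
  exact ⟨P, a, -b, hP, by simp⟩

theorem FactorsThroughProjective.zero {A : Type u} [CommRing A] (X Y : ModuleCat.{u} A) :
    FactorsThroughProjective (0 : X ⟶ Y) :=
  ⟨ModuleCat.of A PUnit.{u + 1}, 0, 0, inferInstanceAs (Module.Projective A PUnit.{u + 1}), by simp⟩

instance stableRel_congruence (A : Type u) [CommRing A] : Congruence (stableRel A) where
  equivalence :=
    { refl := fun f => by
        simpa [stableRel] using FactorsThroughProjective.zero _ _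
      symm := fun {f g} h => by
        simpa [stableRel] using FactorsThroughProjective.neg h
      trans := fun {f g h} h₁ h₂ => by
        simpa [stableRel] using FactorsThroughProjective.add h₁ h₂ }
  comp_left := fun f g g' h => by
    obtain ⟨P, a, b, hP, hab⟩ := h
    exact ⟨P, f ≫ a, b, hP, by simp [hab]⟩
  comp_right := fun {_ _ _ f f'} g h => by
    obtain ⟨P, a, b, hP, hab⟩ := h
    exact ⟨P, a, b ≫ g, hP, by rw [← Category.assoc, hab, Preadditive.sub_comp]⟩

/-- The stable module category: its objects are the `A`-modules, and the morphisms from `M` to `N`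
are the elements of `Hom_A(M, N) / P(M, N)`, where `P(M, N)` is the set of homomorphisms that
factor through a projective module. The stable category of Cohen-Macaulay modules is the full
subcategory whose objects satisfy `IsCM`. -/
abbrev StableMod (A : Type u) [CommRing A] : Type (u + 1) := Quotient (stableRel A)

theorem stableRel_add {A : Type u} [CommRing A] ⦃X Y : ModuleCat.{u} A⦄
    (f₁ f₂ g₁ g₂ : X ⟶ Y) (h₁ : stableRel A f₁ f₂) (h₂ : stableRel A g₁ g₂) :
    stableRel A (f₁ + g₁) (f₂ + g₂) := by
  have h := FactorsThroughProjective.add h₁ h₂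
  have e : f₁ - f₂ + (g₁ - g₂) = f₁ + g₁ - (f₂ + g₂) := by abel
  rw [e] at h
  exact h

instance stableMod_preadditive (A : Type u) [CommRing A] : Preadditive (StableMod A) :=
  Quotient.preadditive (stableRel A) stableRel_add

/-- The canonical functor to the stable category. -/
abbrev stab (A : Type u) [CommRing A] : ModuleCat.{u} A ⥤ StableMod A :=
  Quotient.functor (stableRel A)

/-! ### Triangles in the stable category of Cohen-Macaulay modules -/

/-- An embedding of `L` into a finitely generated projective module `P` whose cokernel `C` is
Cohen-Macaulay. The module `C` represents the shift `L[1]`. -/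
structure Cosyzygy {A : Type u} [CommRing A] (L : ModuleCat.{u} A) where
  P : ModuleCat.{u} A
  C : ModuleCat.{u} A
  ι : L ⟶ P
  π : P ⟶ C
  finite : Module.Finite A P
  projective : Module.Projective A P
  isCM : IsCM C
  zero : ι ≫ π = 0
  shortExact : (ShortComplex.mk ι π zero).ShortExact

/-- `β` is the shift `α[1]` of the stable morphism `α`, computed with the embeddings `c`, `c'`. -/
def IsShift {A : Type u} [CommRing A] {L L' : ModuleCat.{u} A} (c : Cosyzygy L) (c' : Cosyzygy L')
    (α : (stab A).obj L ⟶ (stab A).obj L') (β : (stab A).obj c.C ⟶ (stab A).obj c'.C) : Prop :=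
  ∃ (a : L ⟶ L') (p : c.P ⟶ c'.P) (b : c.C ⟶ c'.C),
    c.ι ≫ p = a ≫ c'.ι ∧ c.π ≫ b = p ≫ c'.π ∧ (stab A).map a = α ∧ (stab A).map b = β

/-- `X → Y → W → X[1]` is a triangle in the stable category of Cohen-Macaulay modules, where `X[1]`
is computed with `c`: it is isomorphic to a sequence `L → M → N → L[1]` that comes from an exact
sequence `0 → L → M → N → 0` of Cohen-Macaulay modules and a commutative diagram from this
sequence to an exact sequence `0 → L → P → L[1] → 0` that is the identity on `L`. -/
def IsTriangle {A : Type u} [CommRing A] {X Y W : ModuleCat.{u} A} (c : Cosyzygy X)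
    (f : (stab A).obj X ⟶ (stab A).obj Y) (g : (stab A).obj Y ⟶ (stab A).obj W)
    (h : (stab A).obj W ⟶ (stab A).obj c.C) : Prop :=
  ∃ (S : ShortComplex (ModuleCat.{u} A)) (d : Cosyzygy S.X₁) (p : S.X₂ ⟶ d.P) (q : S.X₃ ⟶ d.C)
    (α : (stab A).obj S.X₁ ≅ (stab A).obj X) (β : (stab A).obj S.X₂ ≅ (stab A).obj Y)
    (γ : (stab A).obj S.X₃ ≅ (stab A).obj W) (δ : (stab A).obj d.C ≅ (stab A).obj c.C),
    S.ShortExact ∧ IsCM S.X₁ ∧ IsCM S.X₂ ∧ IsCM S.X₃ ∧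
    S.f ≫ p = d.ι ∧ S.g ≫ q = p ≫ d.π ∧
    IsShift d c α.hom δ.hom ∧
    α.hom ≫ f = (stab A).map S.f ≫ β.hom ∧
    β.hom ≫ g = (stab A).map S.g ≫ γ.hom ∧
    γ.hom ≫ h = (stab A).map q ≫ δ.hom

/-- There is a triangle `Z → M ⊕ Z → N → Z[1]` in the stable category of Cohen-Macaulay
`A`-modules, with first morphism `(φ, ψ)`, where `ψ` is a nilpotent element of the stable
endomorphism ring of `Z`. -/
def HasNilpotentTriangle (A : Type u) [CommRing A] (M N : ModuleCat.{u} A) : Prop :=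
  IsCM M ∧ IsCM N ∧ ∃ (Z : ModuleCat.{u} A) (c : Cosyzygy Z)
    (φ : (stab A).obj Z ⟶ (stab A).obj M) (ψ : End ((stab A).obj Z))
    (g : (stab A).obj (ModuleCat.of A (M × Z)) ⟶ (stab A).obj N)
    (h : (stab A).obj N ⟶ (stab A).obj c.C),
    IsCM Z ∧ IsNilpotent ψ ∧
    IsTriangle c (φ ≫ (stab A).map (ModuleCat.ofHom (LinearMap.inl A M Z)) +
      ψ ≫ (stab A).map (ModuleCat.ofHom (LinearMap.inr A M Z))) g h

/-! ### Degenerations and stable degenerations -/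

section Families

variable (k : Type u) [Field k] (R : Type u) [CommRing R] [Algebra k R]

/-- The ring homomorphism `R ⊗ V → R ⊗ W` for a `V`-algebra `W`. -/
def familyMap (V W : Type u) [CommRing V] [Algebra k V] [CommRing W] [Algebra k W] [Algebra V W]
    [IsScalarTower k V W] : R ⊗[k] V →+* R ⊗[k] W :=
  (Algebra.TensorProduct.map (AlgHom.id k R) (IsScalarTower.toAlgHom k V W)).toRingHom

/-- The `R ⊗ W`-module `Q ⊗_V W = Q ⊗_{R ⊗ V} (R ⊗ W)`. -/
abbrev fibreOver (V W : Type u) [CommRing V] [Algebra k V] [CommRing W] [Algebra k W] [Algebra V W]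
    [IsScalarTower k V W] (Q : ModuleCat.{u} (R ⊗[k] V)) : ModuleCat.{u} (R ⊗[k] W) :=
  (ModuleCat.extendScalars (familyMap k R V W)).obj Q

/-- The `R ⊗ W`-module `M ⊗_k W = M ⊗_R (R ⊗ W)`. -/
abbrev constFamily (W : Type u) [CommRing W] [Algebra k W] (M : ModuleCat.{u} R) :
    ModuleCat.{u} (R ⊗[k] W) :=
  (ModuleCat.extendScalars (algebraMap R (R ⊗[k] W))).obj M

/-- The `R`-module `Q / tQ`. -/
abbrev specialFibre (V : Type u) [CommRing V] [Algebra k V] (t : V)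
    (Q : ModuleCat.{u} (R ⊗[k] V)) : ModuleCat.{u} R :=
  (ModuleCat.restrictScalars (algebraMap R (R ⊗[k] V))).obj
    (ModuleCat.of (R ⊗[k] V) (QuotSMulTop ((1 : R) ⊗ₜ[k] t) Q))

/-- The `R ⊗ V`-module `Q`, regarded as a `V`-module. -/
abbrev overBase (V : Type u) [CommRing V] [Algebra k V] (Q : ModuleCat.{u} (R ⊗[k] V)) :
    ModuleCat.{u} V :=
  (ModuleCat.restrictScalars
    (Algebra.TensorProduct.includeRight : V →ₐ[k] R ⊗[k] V).toRingHom).obj Q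

/-- `M` degenerates to `N`: there are a discrete valuation ring `(V, tV, k)` that is a `k`-algebra
and a finitely generated `R ⊗ V`-module `Q` that is flat over `V`, such that `Q / tQ ≅ N` and
`Q[1/t] ≅ M ⊗_k V[1/t]`. (Each such `V` embeds in `k⟦t⟧`, so the universe of `V` and `Q` is no
restriction.) -/
def Degenerates (M N : ModuleCat.{u} R) : Prop :=
  ∃ (V : Type u) (_ : CommRing V) (_ : IsDomain V) (_ : IsDiscreteValuationRing V)
    (_ : Algebra k V) (t : V) (Q : ModuleCat.{u} (R ⊗[k] V)),
    Irreducible t ∧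
    Function.Bijective (algebraMap k (V ⧸ Ideal.span {t})) ∧
    Module.Finite (R ⊗[k] V) Q ∧
    Module.Flat V (overBase k R V Q) ∧
    Nonempty (specialFibre k R V t Q ≅ N) ∧
    Nonempty (fibreOver k R V (Localization.Away t) Q ≅ constFamily k R (Localization.Away t) M)

/-- The ideal `(t)` of `k[t]`. -/
abbrev tIdeal : Ideal (Polynomial k) := Ideal.span {Polynomial.X}

instance tIdeal_isPrime : (tIdeal k).IsPrime :=
  (Ideal.span_singleton_prime Polynomial.X_ne_zero).2 Polynomial.prime_X

/-- The discrete valuation ring `V = k[t]_(t)`; its fraction field is `K = k(t)`. -/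
def LocalLine : Type u := Localization.AtPrime (tIdeal k)

instance : CommRing (LocalLine k) := inferInstanceAs (CommRing (Localization.AtPrime (tIdeal k)))

instance : Algebra (Polynomial k) (LocalLine k) :=
  inferInstanceAs (Algebra (Polynomial k) (Localization.AtPrime (tIdeal k)))

instance : Algebra k (LocalLine k) :=
  inferInstanceAs (Algebra k (Localization.AtPrime (tIdeal k)))

instance : IsScalarTower k (Polynomial k) (LocalLine k) :=
  inferInstanceAs (IsScalarTower k (Polynomial k) (Localization.AtPrime (tIdeal k)))

instance : IsLocalization.AtPrime (LocalLine k) (tIdeal k) :=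
  inferInstanceAs (IsLocalization.AtPrime (Localization.AtPrime (tIdeal k)) (tIdeal k))

/-- `M` stably degenerates to `N`: there is a Cohen-Macaulay module `Q` over `R ⊗ V`, where
`V = k[t]_(t)`, such that `Q ⊗_V K ≅ M ⊗_k K` in the stable category over `R ⊗ K`, where
`K = k(t)`, and `Q / tQ ≅ N` in the stable category over `R`. -/
def StablyDegenerates (M N : ModuleCat.{u} R) : Prop :=
  IsCM M ∧ IsCM N ∧ ∃ Q : ModuleCat.{u} (R ⊗[k] LocalLine k), IsCM Q ∧
    Nonempty ((stab _).obj (fibreOver k R (LocalLine k) (FractionRing (LocalLine k)) Q) ≅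
      (stab _).obj (constFamily k R (FractionRing (LocalLine k)) M)) ∧
    Nonempty ((stab _).obj
      (specialFibre k R (LocalLine k) (algebraMap (Polynomial k) (LocalLine k) Polynomial.X) Q) ≅
      (stab _).obj N)

/-- `R^m ⊕ M` degenerates to `R^n ⊕ N` for some natural numbers `m`, `n`. -/
def DegeneratesUpToFree (M N : ModuleCat.{u} R) : Prop :=
  ∃ m n : ℕ, Degenerates k R (ModuleCat.of R ((Fin m → R) × M)) (ModuleCat.of R ((Fin n → R) × N))

end Families

/-! ### The cusp -/

section Cusp

open PowerSeries

variable (k : Type u) [Field k]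

/-- The subring `k[[s^2, s^3]]` of `k[[s]]`: the power series with no linear term. By
`cusp_eq_range` below these are the power series in `s^2` and `s^3`. -/
def cusp : Subalgebra k k⟦X⟧ where
  carrier := {f | coeff 1 f = 0}
  mul_mem' := by
    intro f g hf hg
    change coeff 1 _ = 0 at *
    rw [coeff_mul, Finset.Nat.antidiagonal_succ]
    simp [hf, hg]
  add_mem' := by
    intro f g hf hg
    change coeff 1 _ = 0 at *
    simp [hf, hg]
  algebraMap_mem' := by
    intro r
    simp

theorem mem_cusp (f : k⟦X⟧) : f ∈ cusp k ↔ coeff 1 f = 0 := Iff.rfl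

/-- The element `s^2`. -/
def cuspX : cusp k := ⟨X ^ 2, by rw [mem_cusp, coeff_X_pow]; simp⟩

/-- The element `s^3`. -/
def cuspY : cusp k := ⟨X ^ 3, by rw [mem_cusp, coeff_X_pow]; simp⟩

/-- The ideal `(s^2, s^3)` of the cusp. -/
def cuspIdeal : Ideal (cusp k) := Ideal.span {cuspX k, cuspY k}

/-- The ideal `(s^2, s^3)`, regarded as a module over the cusp. -/
def cuspIdealModule : ModuleCat.{u} (cusp k) :=
  @ModuleCat.of (cusp k) _ (cuspIdeal k) _ (Submodule.module (cuspIdeal k))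

theorem cusp_hasSubst :
    MvPowerSeries.HasSubst (![X ^ 2, X ^ 3] : Fin 2 → MvPowerSeries Unit k) := by
  apply MvPowerSeries.hasSubst_of_constantCoeff_zero
  intro i
  fin_cases i
  · change PowerSeries.constantCoeff (X ^ 2 : k⟦X⟧) = 0
    simp
  · change PowerSeries.constantCoeff (X ^ 3 : k⟦X⟧) = 0
    simp

theorem cusp_coeff_subst (g : MvPowerSeries (Fin 2) k) (n : ℕ) :
    coeff n (MvPowerSeries.substAlgHom (R := k) (cusp_hasSubst k) g : k⟦X⟧) =
      ∑ᶠ d : Fin 2 →₀ ℕ, MvPowerSeries.coeff d g * if n = 2 * d 0 + 3 * d 1 then 1 else 0 := by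
  rw [MvPowerSeries.substAlgHom_apply]
  refine (MvPowerSeries.coeff_subst (cusp_hasSubst k) g _).trans ?_
  refine finsum_congr fun d => ?_
  rw [smul_eq_mul]
  congr 1
  rw [Finsupp.prod_fintype _ _ (fun i => pow_zero _), Fin.prod_univ_two]
  change coeff n ((X ^ 2 : k⟦X⟧) ^ d 0 * (X ^ 3 : k⟦X⟧) ^ d 1) = _
  rw [← pow_mul, ← pow_mul, ← pow_add, coeff_X_pow]

/-- The cusp is the image of `k[[x, y]] → k[[s]]`, `x ↦ s^2`, `y ↦ s^3`. -/
theorem cusp_eq_range : cusp k = (MvPowerSeries.substAlgHom (R := k) (cusp_hasSubst k)).range := by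
  apply le_antisymm
  · intro f hf
    rw [mem_cusp] at hf
    let g : MvPowerSeries (Fin 2) k := fun d =>
      if d 1 = 0 then coeff (2 * d 0) f else if d 1 = 1 then coeff (2 * d 0 + 3) f else 0
    refine ⟨g, ?_⟩
    refine PowerSeries.ext fun n => ?_
    refine (cusp_coeff_subst k g n).trans ?_
    have hg : ∀ d, MvPowerSeries.coeff d g =
      if d 1 = 0 then coeff (2 * d 0) f else if d 1 = 1 then coeff (2 * d 0 + 3) f else 0 :=
      fun d => rfl
    have key : ∀ p q : ℕ, n = 2 * p + 3 * q → q ≤ 1 →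
        ∑ᶠ d : Fin 2 →₀ ℕ, MvPowerSeries.coeff d g * (if n = 2 * d 0 + 3 * d 1 then 1 else 0) =
          coeff n f := by
      intro p q hn hq
      let e : Fin 2 →₀ ℕ := Finsupp.equivFunOnFinite.symm ![p, q]
      have e0 : e 0 = p := rfl
      have e1 : e 1 = q := rfl
      rw [finsum_eq_single _ e]
      · rw [hg, e0, e1, if_pos hn, mul_one]
        obtain rfl | rfl : q = 0 ∨ q = 1 := by omega
        · simp [hn]
        · simp [hn]
      · intro d hd
        rw [hg]
        split_ifs with h0 h1 h2 h3 <;> try simp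
        · exfalso
          apply hd
          ext i
          fin_cases i
          · change d 0 = p
            omega
          · change d 1 = q
            omega
        · exfalso
          apply hd
          ext i
          fin_cases i
          · change d 0 = p
            omega
          · change d 1 = q
            omega
    rcases Nat.even_or_odd' n with ⟨p, hp | hp⟩
    · exact key p 0 (by omega) (by omega)
    · rcases p with _ | p
      · have hn : n = 1 := by omega
        subst hn
        rw [hf]
        refine finsum_eq_zero_of_forall_eq_zero fun d => ?_
        rw [if_neg (by omega), mul_zero]
      · exact key p 1 (by omega) (by omega)
  · rintro _ ⟨g, rfl⟩
    rw [mem_cusp]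
    refine (cusp_coeff_subst k g 1).trans ?_
    refine finsum_eq_zero_of_forall_eq_zero fun d => ?_
    rw [if_neg (by omega), mul_zero]

end Cusp

end

/-!
The cusp `R = k⟦s², s³⟧` is the quadratic extension `k⟦x⟧ ⊕ k⟦x⟧ y`, `y² = x³`, of the power series
ring in `x = s²`. The form `p + q y ↦ q` turns problems of extending linear maps to `R` into
problems over `k⟦x⟧`. So finitely generated `R`-modules that are free over `k⟦x⟧` are
Cohen-Macaulay, and `R` has injective dimension at most one (`IsQuadratic.isCM`,
`IsQuadratic.hasInjectiveDimensionLE_one`). The same form serves for `R ⊗ V`.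

Multiplication by `s` on `𝔪` is stably nilpotent, since multiplication by `s²` factors as
`𝔪 ⊂ R → 𝔪`. The exact sequence `0 → 𝔪 → 𝔪 ⊕ R → 𝔪 → 0` with first map `g ↦ (s g, g)` then gives the
triangle (`cusp_hasNilpotentTriangle`).

The stable degeneration is the ideal of the moving point `(t², t³)` of the cusp, presented by a
`2 × 2` matrix factorization of `y² - x³`. Its special fibre is `𝔪`, and it becomes projective when
`t` is inverted, because `t⁴` is a combination of the entries of the matrix
(`cusp_stablyDegenerates`).

To see that `R^m` does not degenerate to `R^n ⊕ 𝔪`, let `Q` be a family whose special fibre is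
`N = R^n ⊕ 𝔪 ⊆ R^(n+1)`. As `Ext¹(N, R) = 0`, functionals on `tQ` extend to `Q`, and the inclusion
of `N` lifts, coefficient by coefficient, to a map `H : Q → R⟦X⟧^(n+1)` that is semilinear along the
expansion `R ⊗ V → R⟦X⟧` in powers of `t` (`exists_lift_expansion`). If `Q` is generically free of
rank `m`, the image under `H` of a generic basis is a matrix `G`. Elements of `Q` that lift a basis
of `R^n` together with `s²`, or with `s³`, show that `m = n + 1` and that `det G` divides, up to
powers of `X`, two series with constant terms `s²` and `s³`. These have no common divisors in `R`
but units, so `det G` is a unit times a power of `X`. By Cramer's rule each vector over `R` is then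
the constant term of an element of `H(Q)`, so `N = R^(n+1)` (`surjective_of_degenerates`), which is
false.
-/

noncomputable section

/-! ### Ext groups of modules over quadratic extensions -/

section Homological

open Abelian

variable {A : Type u} [CommRing A]

/-- If `Ext¹(P / M, X) = 0`, then every map from the submodule `M` of `P` to `X` extends to `P`. -/
theorem exists_extension_of_subsingleton_ext {S : ShortComplex (ModuleCat.{u} A)}
    (hS : S.ShortExact) (X : ModuleCat.{u} A) (h : Subsingleton (Ext S.X₃ X 1)) (φ : S.X₁ ⟶ X) :
    ∃ ψ : S.X₂ ⟶ X, S.f ≫ ψ = φ := by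
  obtain ⟨x, hx⟩ := Ext.contravariant_sequence_exact₁ hS _ (Ext.mk₀ φ) (add_zero 1)
    (Subsingleton.elim _ _)
  obtain ⟨ψ, rfl⟩ := Ext.homEquiv₀.symm.surjective x
  exact ⟨ψ, Ext.homEquiv₀.symm.injective (by simpa using hx)⟩

theorem subsingleton_ext_one_of_exists_extension {S : ShortComplex (ModuleCat.{u} A)}
    (hS : S.ShortExact) [Projective S.X₂] (X : ModuleCat.{u} A)
    (h : ∀ φ : S.X₁ ⟶ X, ∃ ψ : S.X₂ ⟶ X, S.f ≫ ψ = φ) : Subsingleton (Ext S.X₃ X 1) := by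
  refine subsingleton_of_forall_eq 0 fun e => ?_
  obtain ⟨x, rfl⟩ := Ext.contravariant_sequence_exact₃ hS X e (Ext.eq_zero_of_projective _)
    (add_zero 1)
  obtain ⟨φ, rfl⟩ := Ext.homEquiv₀.symm.surjective x
  obtain ⟨ψ, rfl⟩ := h φ
  simp only [Ext.homEquiv₀_symm_apply, ← Ext.mk₀_comp_mk₀]
  exact hS.extClass_comp_assoc _

theorem subsingleton_ext_succ {S : ShortComplex (ModuleCat.{u} A)}
    (hS : S.ShortExact) [Projective S.X₂] (X : ModuleCat.{u} A) {n : ℕ}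
    (h : Subsingleton (Ext S.X₁ X n)) : Subsingleton (Ext S.X₃ X (n + 1)) := by
  refine subsingleton_of_forall_eq 0 fun e => ?_
  obtain ⟨x, rfl⟩ := Ext.contravariant_sequence_exact₃ hS X e (Ext.eq_zero_of_projective _)
    (add_comm 1 n)
  rw [Subsingleton.elim x 0, Ext.comp_zero]

/-- A principal ideal domain `B` has the injective resolution `0 → B → Frac B → Frac B / B → 0`. -/
theorem hasInjectiveDimensionLE_one_of_isPrincipalIdealRing (B : Type u) [CommRing B] [IsDomain B]
    [IsPrincipalIdealRing B] : HasInjectiveDimensionLE (ModuleCat.of B B) 1 := by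
  -- over a principal ideal domain, divisible modules are injective
  have key : ∀ (Q : Type u) [AddCommGroup Q] [Module B Q],
      (∀ (a : B) (z : Q), a ≠ 0 → ∃ w : Q, a • w = z) → Injective (ModuleCat.of B Q) := by
    intro Q _ _ hQ
    rw [← Module.injective_iff_injective_object]
    refine Module.Baer.injective fun I g => ?_
    obtain ⟨a, rfl⟩ := (IsPrincipalIdealRing.principal I).principal
    have ha : a ∈ Submodule.span B {a} := Submodule.mem_span_singleton_self a
    obtain rfl | h0 := eq_or_ne a 0
    · refine ⟨0, fun x hx => ?_⟩
      obtain rfl : x = 0 := by simpa using hx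
      exact (map_zero g).symm
    · obtain ⟨w, hw⟩ := hQ a (g ⟨a, ha⟩) h0
      refine ⟨LinearMap.toSpanSingleton B Q w, fun x hx => ?_⟩
      obtain ⟨r, rfl⟩ := Submodule.mem_span_singleton.1 hx
      rw [LinearMap.toSpanSingleton_apply, smul_assoc, hw, ← map_smul]
      rfl
  let K := FractionRing B
  have hdiv : ∀ (a : B) (z : K), a ≠ 0 → ∃ w : K, a • w = z := fun a z ha =>
    ⟨(algebraMap B K a)⁻¹ * z, by
      rw [Algebra.smul_def, mul_inv_cancel_left₀]
      simpa using ha⟩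
  let f : B →ₗ[B] K := Algebra.linearMap B K
  let S : ShortComplex (ModuleCat.{u} B) :=
    ModuleCat.shortComplexOfCompEqZero f (LinearMap.range f).mkQ
      f.exact_map_mkQ_range.linearMap_comp_eq_zero
  have hS : S.ShortExact := ModuleCat.shortComplex_shortExact S f.exact_map_mkQ_range
    (IsFractionRing.injective B K) (Submodule.mkQ_surjective _)
  have h2 : Injective S.X₂ := key K hdiv
  have h3 : Injective S.X₃ := key (K ⧸ LinearMap.range f) fun a z ha => by
    obtain ⟨z, rfl⟩ := Submodule.mkQ_surjective _ z
    obtain ⟨w, rfl⟩ := hdiv a z ha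
    exact ⟨Submodule.mkQ _ w, rfl⟩
  exact (hS.hasInjectiveDimensionLT_X₃_iff 0 h2).1 inferInstance

end Homological

/-- The ring `A` is the quadratic extension `S ⊕ S y` of `S`, with `y ^ 2 = c`. -/
structure IsQuadratic (S A : Type u) [CommRing S] [CommRing A] [Algebra S A] (y : A) (c : S) :
    Prop where
  sq : y * y = algebraMap S A c
  bij : Function.Bijective fun p : S × S => algebraMap S A p.1 + algebraMap S A p.2 * y

theorem shortExact_ker_restrictScalars {S A P Y : Type u} [CommRing S] [CommRing A] [Algebra S A]
    [AddCommGroup P] [Module A P] [Module S P] [IsScalarTower S A P]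
    [AddCommGroup Y] [Module A Y] [Module S Y] [IsScalarTower S A Y]
    (f : P →ₗ[A] Y) (hf : Function.Surjective f) :
    (ShortComplex.mk
      (ModuleCat.ofHom (X := LinearMap.ker f) ((LinearMap.ker f).subtype.restrictScalars S))
      (ModuleCat.ofHom (f.restrictScalars S))
      (ModuleCat.hom_ext (LinearMap.ext fun x => x.2))).ShortExact :=
  ModuleCat.shortComplex_shortExact _
    (fun x => ⟨fun hx => ⟨⟨x, hx⟩, rfl⟩, fun ⟨z, hz⟩ => hz ▸ z.2⟩)
    Subtype.val_injective hf

namespace IsQuadratic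

variable {S A : Type u} [CommRing S] [CommRing A] [Algebra S A] {y : A} {c : S}
  (h : IsQuadratic S A y c)

include h

/-- The coordinates of an element of `S ⊕ S y`. -/
def equiv : (S × S) ≃ₗ[S] A :=
  LinearEquiv.ofBijective
    ((Algebra.linearMap S A).coprod (LinearMap.toSpanSingleton S A y)) (by
      convert h.bij using 2
      simp [Algebra.smul_def])

theorem equiv_apply (p : S × S) : h.equiv p = algebraMap S A p.1 + algebraMap S A p.2 * y := by
  simp [equiv, Algebra.smul_def]

theorem finite : Module.Finite S A := Module.Finite.equiv h.equiv

theorem free : Module.Free S A := Module.Free.of_equiv h.equiv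

/-- The trace form `p + q y ↦ q` makes `A` a Frobenius extension of `S`: an `S`-linear map
`ψ : Q → S` is the composite of the form with a unique `A`-linear map. Hence `A`-linear maps to `A`
extend along an injection as soon as `S`-linear maps to `S` do. -/
theorem exists_extension {K P : Type u} [AddCommGroup K] [Module A K] [Module S K]
    [IsScalarTower S A K] [AddCommGroup P] [Module A P] [Module S P] [IsScalarTower S A P]
    (f : K →ₗ[A] P) (hf : ∀ φ : K →ₗ[S] S, ∃ ψ : P →ₗ[S] S, ∀ x, ψ (f x) = φ x)
    (φ : K →ₗ[A] A) : ∃ ψ : P →ₗ[A] A, ψ ∘ₗ f = φ := by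
  let τ : A →ₗ[S] S := LinearMap.snd S S S ∘ₗ h.equiv.symm.toLinearMap
  obtain ⟨ψ, hψ⟩ := hf (τ ∘ₗ φ.restrictScalars S)
  have hτ : ∀ p q : S, τ (algebraMap S A p + algebraMap S A q * y) = q := by
    intro p q
    have : algebraMap S A p + algebraMap S A q * y = h.equiv (p, q) := (h.equiv_apply (p, q)).symm
    simp [τ, this]
  have hy : ∀ a b : S, y * (algebraMap S A a + algebraMap S A b * y) =
      algebraMap S A (c * b) + algebraMap S A a * y := by
    intro a b
    rw [map_mul, ← h.sq]
    ring
  have hsurj : ∀ a : A, ∃ p q : S, a = algebraMap S A p + algebraMap S A q * y := fun a => by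
    obtain ⟨⟨p, q⟩, rfl⟩ := h.bij.2 a
    exact ⟨p, q, rfl⟩
  have hSA : ∀ (s : S) (x : P), s • x = algebraMap S A s • x := fun s x =>
    (algebraMap_smul A s x).symm
  -- the `A`-linear map `x ↦ ψ (y x) + ψ (x) y`
  let Ψ : P →ₗ[A] A :=
    { toFun := fun x => algebraMap S A (ψ (y • x)) + algebraMap S A (ψ x) * y
      map_add' := fun x x' => by simp only [smul_add, map_add]; ring
      map_smul' := fun a x => by
        obtain ⟨p, q, rfl⟩ := hsurj a
        have e1 : (algebraMap S A p + algebraMap S A q * y) • x = p • x + q • (y • x) := by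
          rw [add_smul, mul_smul, ← hSA, ← hSA]
        have e2 : y • (algebraMap S A p + algebraMap S A q * y) • x =
            p • (y • x) + (q * c) • x := by
          rw [smul_smul, hy, add_smul, mul_smul, ← hSA, ← hSA, add_comm, mul_comm c]
        rw [e2, e1]
        simp only [map_add, map_smul, smul_eq_mul, map_mul, RingHom.id_apply, ← h.sq]
        ring }
  refine ⟨Ψ, LinearMap.ext fun x => ?_⟩
  obtain ⟨p, q, hpq⟩ := hsurj (φ x)
  have h1 : ψ (f x) = q := by
    rw [hψ]
    change τ (φ x) = q
    rw [hpq, hτ]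
  have h2 : ψ (y • f x) = p := by
    rw [← map_smul, hψ]
    change τ (φ (y • x)) = p
    rw [map_smul, hpq, smul_eq_mul, hy, hτ]
  change algebraMap S A (ψ (y • f x)) + algebraMap S A (ψ (f x)) * y = φ x
  rw [h1, h2, hpq]

open Abelian

/-- The extension problems that compute `Ext¹(Y, A)` reduce to those for `Ext¹(Y, S)`. -/
theorem subsingleton_ext_one (Y : ModuleCat.{u} A) [Module S Y] [IsScalarTower S A Y]
    (hY : Subsingleton (Ext (ModuleCat.of S Y) (ModuleCat.of S S) 1)) :
    Subsingleton (Ext Y (ModuleCat.of A A) 1) := by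
  let f : (Y →₀ A) →ₗ[A] Y := Finsupp.linearCombination A id
  have hf : Function.Surjective f := fun x => ⟨Finsupp.single x 1, by simp [f]⟩
  have hproj : Projective f.shortComplexKer.X₂ :=
    (IsProjective.iff_projective (R := A) (Y →₀ A)).1 inferInstance
  refine subsingleton_ext_one_of_exists_extension (LinearMap.shortExact_shortComplexKer hf) _
    fun φ => ?_
  obtain ⟨ψ, hψ⟩ := h.exists_extension (LinearMap.ker f).subtype (fun φ => by
    obtain ⟨ψ, hψ⟩ := exists_extension_of_subsingleton_ext
      (shortExact_ker_restrictScalars (S := S) f hf) (ModuleCat.of S S) hY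
      (ModuleCat.ofHom φ)
    exact ⟨ψ.hom, fun x => LinearMap.congr_fun (congrArg ModuleCat.Hom.hom hψ) x⟩) φ.hom
  exact ⟨ModuleCat.ofHom ψ, ModuleCat.hom_ext hψ⟩

/-- Syzygies of an `S`-projective module are `S`-projective, so the vanishing of `Ext¹` suffices. -/
theorem subsingleton_ext_of_projective (n : ℕ) : ∀ (Y : ModuleCat.{u} A) [Module S Y]
    [IsScalarTower S A Y] [Module.Projective S Y],
    Subsingleton (Ext Y (ModuleCat.of A A) (n + 1)) := by
  have hfree := h.free
  induction n with
  | zero =>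
    intro Y _ _ _
    exact h.subsingleton_ext_one Y (subsingleton_of_forall_eq 0 fun e => by
      have := (IsProjective.iff_projective (R := S) Y).1 inferInstance
      exact e.eq_zero_of_projective)
  | succ n ih =>
    intro Y _ _ _
    let f : (Y →₀ A) →ₗ[A] Y := Finsupp.linearCombination A id
    have hf : Function.Surjective f := fun x => ⟨Finsupp.single x 1, by simp [f]⟩
    obtain ⟨σ, hσ⟩ := Module.projective_lifting_property (f.restrictScalars S) LinearMap.id hf
    replace hσ : ∀ x, f (σ x) = x := fun x => LinearMap.congr_fun hσ x
    let ι : LinearMap.ker f →ₗ[S] (Y →₀ A) := (LinearMap.ker f).subtype.restrictScalars S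
    let π : (Y →₀ A) →ₗ[S] LinearMap.ker f :=
      { toFun := fun x => ⟨x - σ (f x), by simp [hσ]⟩
        map_add' := fun x x' => Subtype.ext <| by
          change x + x' - σ (f (x + x')) = (x - σ (f x)) + (x' - σ (f x'))
          rw [map_add, map_add]
          abel
        map_smul' := fun s x => Subtype.ext <| by
          change s • x - σ (f.restrictScalars S (s • x)) = s • (x - σ (f x))
          rw [map_smul, map_smul, smul_sub]
          rfl }
    have : Module.Projective S (LinearMap.ker f) := Module.Projective.of_split ι π <|
      LinearMap.ext fun x => Subtype.ext <| by
        have hx : f x.1 = 0 := x.2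
        change x.1 - σ (f x.1) = x.1
        simp [hx]
    have hproj : Projective f.shortComplexKer.X₂ :=
      (IsProjective.iff_projective (R := A) (Y →₀ A)).1 inferInstance
    exact subsingleton_ext_succ (LinearMap.shortExact_shortComplexKer hf) _
      (ih (ModuleCat.of A (LinearMap.ker f)))

/-- A finitely generated `A`-module is Cohen-Macaulay if it is projective over `S`. -/
theorem isCM (Y : ModuleCat.{u} A) [Module S Y] [IsScalarTower S A Y] [Module.Projective S Y]
    [Module.Finite A Y] : IsCM Y :=
  ⟨inferInstance, fun i hi => by
    obtain ⟨n, rfl⟩ := Nat.exists_eq_add_of_le' hi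
    exact h.subsingleton_ext_of_projective n Y⟩

/-- The group `Ext²(Y, A)` is `Ext¹(K, A)` for a first syzygy `K` of `Y`. It vanishes with
`Ext¹(K, S)`, since `K` is contained in a free `S`-module and `S` has injective dimension at most
one. -/
theorem hasInjectiveDimensionLE_one [IsDomain S] [IsPrincipalIdealRing S] :
    HasInjectiveDimensionLE (ModuleCat.of A A) 1 := by
  have hfree := h.free
  have hdim := hasInjectiveDimensionLE_one_of_isPrincipalIdealRing S
  refine hasInjectiveDimensionLT_of_enoughProjectives _ _ fun Y => ?_
  let : Module S Y := Module.compHom Y (algebraMap S A)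
  have : IsScalarTower S A Y := IsScalarTower.of_algebraMap_smul fun _ _ => rfl
  let f : (Y →₀ A) →ₗ[A] Y := Finsupp.linearCombination A id
  have hf : Function.Surjective f := fun x => ⟨Finsupp.single x 1, by simp [f]⟩
  have hproj : Projective f.shortComplexKer.X₂ :=
    (IsProjective.iff_projective (R := A) (Y →₀ A)).1 inferInstance
  refine subsingleton_ext_succ (LinearMap.shortExact_shortComplexKer hf) _
    (h.subsingleton_ext_one (ModuleCat.of A (LinearMap.ker f)) ?_)
  have hT := shortExact_ker_restrictScalars (S := S) f hf
  have hproj' : Projective (ModuleCat.of S (Y →₀ A)) :=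
    (IsProjective.iff_projective (R := S) (Y →₀ A)).1 inferInstance
  refine subsingleton_of_forall_eq 0 fun e => ?_
  obtain ⟨x, rfl⟩ := Ext.contravariant_sequence_exact₁ hT _ e (one_add_one_eq_two)
    (Ext.eq_zero_of_hasInjectiveDimensionLT _ 2 le_rfl)
  have hx : x = 0 := Ext.eq_zero_of_projective (P := ModuleCat.of S (Y →₀ A)) x
  rw [hx, Ext.comp_zero]

end IsQuadratic

/-! ### The cusp as a local Gorenstein domain of dimension one -/

section CuspRing

open PowerSeries

variable (k : Type u) [Field k]

/-- The ring `k⟦x⟧`, where `x` stands for the parameter `s ^ 2` of the cusp. It is kept apart from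
`k⟦X⟧`, of which the cusp is a subalgebra. -/
def CuspBase : Type u := k⟦X⟧

instance : CommRing (CuspBase k) := inferInstanceAs (CommRing k⟦X⟧)

instance : IsDomain (CuspBase k) := inferInstanceAs (IsDomain k⟦X⟧)

instance : IsPrincipalIdealRing (CuspBase k) := inferInstanceAs (IsPrincipalIdealRing k⟦X⟧)

instance : Algebra k (CuspBase k) := inferInstanceAs (Algebra k k⟦X⟧)

/-- The cusp as an algebra over `k⟦x⟧`, where `x` acts as `s ^ 2`. -/
instance cuspAlgebra : Algebra (CuspBase k) (cusp k) :=
  RingHom.toAlgebra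
    ((expand 2 two_ne_zero : k⟦X⟧ →ₐ[k] k⟦X⟧).codRestrict (cusp k) fun f => by
      rw [mem_cusp, coeff_expand_of_not_dvd _ _ _ (by decide)]).toRingHom

/-- The element `x` of `k⟦x⟧`. -/
def cuspBaseX : CuspBase k := (X : k⟦X⟧)

theorem algebraMap_cuspBaseX : algebraMap (CuspBase k) (cusp k) (cuspBaseX k) = cuspX k :=
  Subtype.ext (expand_X 2 two_ne_zero)

instance isScalarTower_cuspBase : IsScalarTower k (CuspBase k) (cusp k) :=
  IsScalarTower.of_algebraMap_eq fun a => Subtype.ext <|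
    ((expand 2 two_ne_zero : k⟦X⟧ →ₐ[k] k⟦X⟧).commutes a).symm

/-- The even part of a series without linear term is a series in `s ^ 2`, and its odd part is
`s ^ 3` times such a series. -/
theorem cusp_isQuadratic : IsQuadratic (CuspBase k) (cusp k) (cuspY k) (cuspBaseX k ^ 3) where
  sq := Subtype.ext <| by
    rw [map_pow, algebraMap_cuspBaseX]
    change (X ^ 3 * X ^ 3 : k⟦X⟧) = (X ^ 2) ^ 3
    ring
  bij := by
    have he : ∀ (p q : k⟦X⟧) (n : ℕ),
        coeff (2 * n) (expand 2 two_ne_zero p + expand 2 two_ne_zero q * X ^ 3) = coeff n p := by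
      intro p q n
      rw [map_add, coeff_expand_mul, coeff_mul_X_pow']
      split_ifs with h
      · rw [coeff_expand_of_not_dvd _ _ _ (by omega), add_zero]
      · rw [add_zero]
    have ho : ∀ (p q : k⟦X⟧) (n : ℕ),
        coeff (2 * n + 3) (expand 2 two_ne_zero p + expand 2 two_ne_zero q * X ^ 3) =
          coeff n q := by
      intro p q n
      rw [map_add, coeff_mul_X_pow, coeff_expand_mul, coeff_expand_of_not_dvd _ _ _ (by omega),
        zero_add]
    constructor
    · intro ⟨(p : k⟦X⟧), (q : k⟦X⟧)⟩ ⟨(p' : k⟦X⟧), (q' : k⟦X⟧)⟩ h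
      replace h : expand 2 two_ne_zero p + expand 2 two_ne_zero q * X ^ 3 =
        expand 2 two_ne_zero p' + expand 2 two_ne_zero q' * X ^ 3 := congrArg Subtype.val h
      refine Prod.ext (PowerSeries.ext fun n => ?_) (PowerSeries.ext fun n => ?_)
      · exact (he p q n).symm.trans ((congrArg _ h).trans (he p' q' n))
      · exact (ho p q n).symm.trans ((congrArg _ h).trans (ho p' q' n))
    · rintro ⟨f, hf⟩
      refine ⟨(mk fun n => coeff (2 * n) f, mk fun n => coeff (2 * n + 3) f),
        Subtype.ext (PowerSeries.ext fun n => ?_)⟩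
      change coeff n (expand 2 two_ne_zero _ + expand 2 two_ne_zero _ * X ^ 3) = coeff n f
      rcases Nat.even_or_odd' n with ⟨m, rfl | rfl⟩
      · rw [he, coeff_mk]
      · rcases m with _ | m
        · rw [map_add, coeff_expand_of_not_dvd _ _ _ (by omega), coeff_mul_X_pow',
            if_neg (by omega), add_zero]
          exact hf.symm
        · rw [show 2 * (m + 1) + 1 = 2 * m + 3 by ring, ho, coeff_mk]

theorem cusp_isNoetherianRing : IsNoetherianRing (cusp k) :=
  have := (cusp_isQuadratic k).finite
  IsNoetherianRing.of_finite (CuspBase k) (cusp k)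

variable {k}

theorem X_sq_mul_mem_cusp (g : k⟦X⟧) : X ^ 2 * g ∈ cusp k := by
  rw [mem_cusp, coeff_X_pow_mul', if_neg (by omega)]

theorem X_sq_dvd_of_mem_cusp {f : k⟦X⟧} (hf : f ∈ cusp k) (h0 : constantCoeff f = 0) :
    X ^ 2 ∣ f := by
  rw [X_pow_dvd_iff]
  intro m hm
  interval_cases m
  · simpa using h0
  · exact hf

theorem mem_cuspIdeal {f : cusp k} : f ∈ cuspIdeal k ↔ constantCoeff (f : k⟦X⟧) = 0 := by
  constructor
  · intro h
    obtain ⟨a, b, rfl⟩ := Ideal.mem_span_pair.1 h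
    simp [cuspX, cuspY]
  · intro h
    obtain ⟨g, hg⟩ := X_sq_dvd_of_mem_cusp f.2 h
    have hmem : g - C (coeff 1 g) * X ∈ cusp k := by
      rw [mem_cusp]
      simp
    refine Ideal.mem_span_pair.2 ⟨⟨_, hmem⟩, algebraMap k _ (coeff 1 g), Subtype.ext ?_⟩
    change (g - C (coeff 1 g) * X) * X ^ 2 + C (coeff 1 g) * X ^ 3 = (f : k⟦X⟧)
    rw [hg]
    ring

theorem X_sq_mul_mem_cuspIdeal (g : k⟦X⟧) : (⟨X ^ 2 * g, X_sq_mul_mem_cusp g⟩ : cusp k) ∈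
    cuspIdeal k := by
  rw [mem_cuspIdeal]
  simp

theorem X_sq_dvd_of_mem_cuspIdeal {f : cusp k} (h : f ∈ cuspIdeal k) : X ^ 2 ∣ (f : k⟦X⟧) :=
  X_sq_dvd_of_mem_cusp f.2 (mem_cuspIdeal.1 h)

theorem isUnit_cusp_iff {f : cusp k} : IsUnit f ↔ constantCoeff (f : k⟦X⟧) ≠ 0 := by
  constructor
  · intro h
    have := (h.map (cusp k).val).map (constantCoeff (R := k))
    exact this.ne_zero
  · intro h
    have h1 : (f : k⟦X⟧) * (f : k⟦X⟧)⁻¹ = 1 := PowerSeries.mul_inv_cancel _ h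
    have hmem : (f : k⟦X⟧)⁻¹ ∈ cusp k := by
      have h2 := congrArg (coeff 1) h1
      rw [coeff_mul, Finset.Nat.antidiagonal_succ] at h2
      have hf : coeff 1 (f : k⟦X⟧) = 0 := f.2
      rw [mem_cusp]
      simpa [hf, h, coeff_one] using h2
    exact IsUnit.of_mul_eq_one ⟨_, hmem⟩ (Subtype.ext h1)

variable (k)

theorem cuspIdeal_ne_top : cuspIdeal k ≠ ⊤ := fun h => by
  have : (1 : cusp k) ∈ cuspIdeal k := h ▸ Submodule.mem_top
  rw [mem_cuspIdeal] at this
  simp at this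

theorem cusp_isLocalRing : IsLocalRing (cusp k) :=
  IsLocalRing.of_nonunits_add fun a b ha hb => by
    rw [mem_nonunits_iff, isUnit_cusp_iff, not_not] at *
    simp [ha, hb]

attribute [local instance] cusp_isLocalRing

theorem cusp_maximalIdeal : IsLocalRing.maximalIdeal (cusp k) = cuspIdeal k := by
  ext f
  rw [IsLocalRing.mem_maximalIdeal, mem_nonunits_iff, isUnit_cusp_iff, not_not, mem_cuspIdeal]

theorem cuspIdeal_isMaximal : (cuspIdeal k).IsMaximal :=
  cusp_maximalIdeal k ▸ IsLocalRing.maximalIdeal.isMaximal _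

theorem cusp_residue_bijective : Function.Bijective (algebraMap k (cusp k ⧸ cuspIdeal k)) := by
  constructor
  · have := Ideal.Quotient.nontrivial_iff.2 (cuspIdeal_ne_top k)
    exact (algebraMap k (cusp k ⧸ cuspIdeal k)).injective
  · intro z
    obtain ⟨f, rfl⟩ := Ideal.Quotient.mk_surjective z
    refine ⟨constantCoeff (f : k⟦X⟧), ?_⟩
    rw [← Ideal.Quotient.mk_algebraMap, Ideal.Quotient.eq, mem_cuspIdeal]
    change constantCoeff (C (constantCoeff (f : k⟦X⟧)) - (f : k⟦X⟧)) = 0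
    simp

/-- If `f` has order `d`, then it divides the `(d + 2)`-nd power of each element of `𝔪`: the
quotient by `f` in `k⟦X⟧` is divisible by `X ^ 2`. -/
theorem cusp_ringKrullDim : ringKrullDim (cusp k) = 1 := by
  rw [ringKrullDim_eq_one_iff_of_isLocalRing_isDomain, cusp_maximalIdeal]
  refine ⟨fun h => ?_, fun f hf z hz => ?_⟩
  · have h1 : IsUnit (cuspX k) := isUnit_iff_exists_inv.2 <| h.mul_inv_cancel fun h0 => by
      have : (X ^ 2 : k⟦X⟧) = 0 := congrArg Subtype.val h0
      exact X_ne_zero (pow_eq_zero_iff two_ne_zero |>.1 this)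
    rw [isUnit_cusp_iff] at h1
    simp [cuspX] at h1
  · obtain ⟨d, hd⟩ := IsDiscreteValuationRing.associated_pow_irreducible
      (fun h => hf (Subtype.ext h) : (f : k⟦X⟧) ≠ 0) (X_prime (R := k)).irreducible
    obtain ⟨g, hg⟩ := hd.dvd
    obtain ⟨w, hw⟩ := X_sq_dvd_of_mem_cuspIdeal hz
    refine ⟨d + 2, Ideal.mem_span_singleton.2
      ⟨⟨X ^ 2 * (g * X ^ (d + 2) * w ^ (d + 2)), X_sq_mul_mem_cusp _⟩, Subtype.ext ?_⟩⟩
    change (z : k⟦X⟧) ^ (d + 2) = (f : k⟦X⟧) * (X ^ 2 * (g * X ^ (d + 2) * w ^ (d + 2)))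
    calc (z : k⟦X⟧) ^ (d + 2) = X ^ d * X ^ (d + 4) * w ^ (d + 2) := by rw [hw]; ring
      _ = (f : k⟦X⟧) * (X ^ 2 * (g * X ^ (d + 2) * w ^ (d + 2))) := by rw [hg]; ring

theorem cusp_isGorensteinLocal : IsGorensteinLocal (cusp k) :=
  ⟨cusp_isNoetherianRing k, cusp_isLocalRing k, 1, (cusp_isQuadratic k).hasInjectiveDimensionLE_one⟩

/-- A short cut to the module structure of the ideal `𝔪`. -/
instance : Module (cusp k) (cuspIdeal k) := Submodule.module (cuspIdeal k)

/-- A finitely generated torsion-free module over the cusp is free over `k⟦x⟧`, hence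
Cohen-Macaulay. -/
theorem isCM_of_le_free {N F : Type u} [AddCommGroup N] [Module (cusp k) N] [AddCommGroup F]
    [Module (cusp k) F] [Module.Finite (cusp k) N] [Module.Free (cusp k) F] (f : N →ₗ[cusp k] F)
    (hf : Function.Injective f) : IsCM (ModuleCat.of (cusp k) N) := by
  have hfin := (cusp_isQuadratic k).finite
  let : Module (CuspBase k) N := Module.compHom N (algebraMap (CuspBase k) (cusp k))
  have : IsScalarTower (CuspBase k) (cusp k) N := IsScalarTower.of_algebraMap_smul fun _ _ => rfl
  have : Module.Finite (CuspBase k) N := Module.Finite.trans (cusp k) N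
  have : Module.IsTorsionFree (cusp k) N := hf.moduleIsTorsionFree f f.map_smul
  have : Module.IsTorsionFree (CuspBase k) (cusp k) :=
    Module.isTorsionFree_iff_algebraMap_injective.2 fun p q hpq =>
      congrArg Prod.fst ((cusp_isQuadratic k).bij.1 (a₁ := (p, 0)) (a₂ := (q, 0))
      (by simp [hpq]))
  have : Module.IsTorsionFree (CuspBase k) N := Module.IsTorsionFree.trans (cusp k)
  have := Module.free_of_finite_type_torsion_free' (R := CuspBase k) (M := N)
  exact (cusp_isQuadratic k).isCM (ModuleCat.of (cusp k) N)

theorem isCM_punit : IsCM (ModuleCat.of (cusp k) PUnit.{u + 1}) :=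
  isCM_of_le_free k (0 : PUnit.{u + 1} →ₗ[cusp k] cusp k) (Function.injective_of_subsingleton _)

theorem isCM_cuspIdealModule : IsCM (cuspIdealModule k) := by
  have := cusp_isNoetherianRing k
  exact isCM_of_le_free k (cuspIdeal k).subtype Subtype.val_injective

theorem isCM_free_prod_cuspIdealModule (ι : Type) [Finite ι] :
    IsCM (ModuleCat.of (cusp k) ((ι → cusp k) × cuspIdealModule k)) := by
  have : Module.Finite (cusp k) (cuspIdealModule k) := (isCM_cuspIdealModule k).1
  exact isCM_of_le_free k
    (LinearMap.prodMap (LinearMap.id : (ι → cusp k) →ₗ[cusp k] _) (cuspIdeal k).subtype)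
    (Function.injective_id.prodMap Subtype.val_injective)

end CuspRing

/-! ### The nilpotent triangle on the maximal ideal of the cusp -/

section Triangle

open PowerSeries

variable (k : Type u) [Field k]

variable {k} in
/-- Multiplication by a power series on `𝔪 = s² k⟦s⟧`. -/
def cuspIdealMul (g : k⟦X⟧) : cuspIdeal k →ₗ[cusp k] cuspIdeal k where
  toFun f := ⟨⟨(f : k⟦X⟧) * g, by
    obtain ⟨w, hw⟩ := X_sq_dvd_of_mem_cuspIdeal f.2
    rw [hw, mul_assoc]
    exact X_sq_mul_mem_cusp _⟩, by
    rw [mem_cuspIdeal]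
    have := mem_cuspIdeal.1 f.2
    simp [this]⟩
  map_add' f f' := Subtype.ext (Subtype.ext (add_mul _ _ _))
  map_smul' r f := Subtype.ext (Subtype.ext (mul_assoc _ _ _))

variable {k} in
/-- The map `R → 𝔪` with value `s² g` at `1`. -/
def toCuspIdeal (g : k⟦X⟧) : cusp k →ₗ[cusp k] cuspIdeal k where
  toFun r := ⟨⟨X ^ 2 * ((r : k⟦X⟧) * g), X_sq_mul_mem_cusp _⟩, X_sq_mul_mem_cuspIdeal _⟩
  map_add' f f' := Subtype.ext <| Subtype.ext <| by
    change X ^ 2 * (((f : k⟦X⟧) + (f' : k⟦X⟧)) * g) =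
      X ^ 2 * ((f : k⟦X⟧) * g) + X ^ 2 * ((f' : k⟦X⟧) * g)
    ring
  map_smul' r f := Subtype.ext <| Subtype.ext <| by
    change X ^ 2 * (((r : k⟦X⟧) * (f : k⟦X⟧)) * g) = (r : k⟦X⟧) * (X ^ 2 * ((f : k⟦X⟧) * g))
    ring

variable {k} in
theorem cuspIdeal_ext {f g : cuspIdeal k} (h : ((f : cusp k) : k⟦X⟧) = ((g : cusp k) : k⟦X⟧)) :
    f = g := Subtype.ext (Subtype.ext h)

/-- If `f` and `s f` both have no linear term, then `f` has no constant term. -/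
theorem mem_cuspIdeal_of_X_mul_mem {f : cusp k} (h : X * (f : k⟦X⟧) ∈ cusp k) :
    f ∈ cuspIdeal k := by
  rw [mem_cuspIdeal]
  rw [mem_cusp, show 1 = 0 + 1 from rfl, coeff_succ_X_mul] at h
  simpa using h

/-- The embedding `g ↦ (g, s g)` of `𝔪` into `R²`. -/
def cuspIdealToSq : cuspIdeal k →ₗ[cusp k] cusp k × cusp k :=
  (cuspIdeal k).subtype.prod ((cuspIdeal k).subtype ∘ₗ cuspIdealMul X)

/-- The cokernel `(p, q) ↦ s³ p - s² q` of the embedding `g ↦ (g, s g)` of `𝔪` into `R²`. -/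
def sqToCuspIdeal : cusp k × cusp k →ₗ[cusp k] cuspIdeal k :=
  (toCuspIdeal X).coprod (toCuspIdeal (-1))

theorem coe_sqToCuspIdeal (x : cusp k × cusp k) : ((sqToCuspIdeal k x : cusp k) : k⟦X⟧) =
    X ^ 2 * ((x.1 : k⟦X⟧) * X) - X ^ 2 * (x.2 : k⟦X⟧) := by
  change X ^ 2 * ((x.1 : k⟦X⟧) * X) + X ^ 2 * ((x.2 : k⟦X⟧) * -1) = _
  ring

/-- `k⟦s⟧ = s R + R`. -/
theorem exists_eq_X_mul_sub (w : k⟦X⟧) : ∃ p q : cusp k, w = (p : k⟦X⟧) * X - (q : k⟦X⟧) := by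
  refine ⟨algebraMap k _ (coeff 1 w), ⟨C (coeff 1 w) * X - w, by simp [mem_cusp]⟩, ?_⟩
  change w = C (coeff 1 w) * X - (C (coeff 1 w) * X - w)
  ring

theorem exact_cuspIdealToSq : Function.Exact (cuspIdealToSq k) (sqToCuspIdeal k) := by
  rintro ⟨p, q⟩
  constructor
  · intro h
    have h1 : X ^ 2 * ((p : k⟦X⟧) * X) - X ^ 2 * (q : k⟦X⟧) = 0 := by
      rw [← coe_sqToCuspIdeal k (p, q), h]
      rfl
    have h2 : (q : k⟦X⟧) = (p : k⟦X⟧) * X := by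
      rw [← mul_sub] at h1
      have := (mul_eq_zero.1 h1).resolve_left (pow_ne_zero 2 X_ne_zero)
      exact (sub_eq_zero.1 this).symm
    have hp : p ∈ cuspIdeal k := mem_cuspIdeal_of_X_mul_mem k (by
      rw [mul_comm, ← h2]
      exact q.2)
    exact ⟨⟨p, hp⟩, Prod.ext rfl (Subtype.ext h2.symm)⟩
  · rintro ⟨g, hg⟩
    rw [← hg]
    refine cuspIdeal_ext ?_
    rw [coe_sqToCuspIdeal]
    change X ^ 2 * (((g : cusp k) : k⟦X⟧) * X) - X ^ 2 * (((g : cusp k) : k⟦X⟧) * X) = 0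
    ring

theorem sqToCuspIdeal_surjective : Function.Surjective (sqToCuspIdeal k) := by
  intro f
  obtain ⟨w, hw⟩ := X_sq_dvd_of_mem_cuspIdeal f.2
  obtain ⟨p, q, hpq⟩ := exists_eq_X_mul_sub k w
  refine ⟨(p, q), cuspIdeal_ext ?_⟩
  rw [coe_sqToCuspIdeal, hw, hpq]
  ring

/-- The exact sequence `0 → 𝔪 → R² → 𝔪 → 0`, which identifies `𝔪[1]` with `𝔪`. -/
def cuspCosyzygy : Cosyzygy (cuspIdealModule k) where
  P := ModuleCat.of (cusp k) (cusp k × cusp k)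
  C := cuspIdealModule k
  ι := ModuleCat.ofHom (cuspIdealToSq k)
  π := ModuleCat.ofHom (sqToCuspIdeal k)
  finite := inferInstanceAs (Module.Finite (cusp k) (cusp k × cusp k))
  projective := inferInstanceAs (Module.Projective (cusp k) (cusp k × cusp k))
  isCM := isCM_cuspIdealModule k
  zero := ModuleCat.hom_ext (exact_cuspIdealToSq k).linearMap_comp_eq_zero
  shortExact := ModuleCat.shortComplex_shortExact _ (exact_cuspIdealToSq k)
    (fun _ _ h => Subtype.ext (congrArg Prod.fst h)) (sqToCuspIdeal_surjective k)

/-- The map `g ↦ (s g, g)` from `𝔪` to `𝔪 ⊕ R`. -/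
def cuspIdealToProd : cuspIdeal k →ₗ[cusp k] cuspIdeal k × cusp k :=
  (cuspIdealMul X).prod (cuspIdeal k).subtype

/-- The cokernel `(f, r) ↦ s f - s² r` of the map `g ↦ (s g, g)` from `𝔪` to `𝔪 ⊕ R`. -/
def prodToCuspIdeal : cuspIdeal k × cusp k →ₗ[cusp k] cuspIdeal k :=
  (cuspIdealMul X).coprod (toCuspIdeal (-1))

theorem coe_prodToCuspIdeal (x : cuspIdeal k × cusp k) :
    ((prodToCuspIdeal k x : cusp k) : k⟦X⟧) =
      ((x.1 : cusp k) : k⟦X⟧) * X - X ^ 2 * (x.2 : k⟦X⟧) := by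
  change ((x.1 : cusp k) : k⟦X⟧) * X + X ^ 2 * ((x.2 : k⟦X⟧) * -1) = _
  ring

theorem exact_cuspIdealToProd : Function.Exact (cuspIdealToProd k) (prodToCuspIdeal k) := by
  rintro ⟨f, r⟩
  constructor
  · intro h
    have h1 : ((f : cusp k) : k⟦X⟧) * X - X ^ 2 * (r : k⟦X⟧) = 0 := by
      rw [← coe_prodToCuspIdeal k (f, r), h]
      rfl
    have h2 : ((f : cusp k) : k⟦X⟧) = (r : k⟦X⟧) * X := by
      have : X * (((f : cusp k) : k⟦X⟧) - (r : k⟦X⟧) * X) = 0 := by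
        rw [← h1]
        ring
      exact sub_eq_zero.1 ((mul_eq_zero.1 this).resolve_left X_ne_zero)
    have hr : r ∈ cuspIdeal k := mem_cuspIdeal_of_X_mul_mem k (by
      rw [mul_comm, ← h2]
      exact (f : cusp k).2)
    exact ⟨⟨r, hr⟩, Prod.ext (cuspIdeal_ext h2.symm) rfl⟩
  · rintro ⟨g, hg⟩
    rw [← hg]
    refine cuspIdeal_ext ?_
    rw [coe_prodToCuspIdeal]
    change ((g : cusp k) : k⟦X⟧) * X * X - X ^ 2 * ((g : cusp k) : k⟦X⟧) = 0
    ring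

theorem prodToCuspIdeal_surjective : Function.Surjective (prodToCuspIdeal k) := by
  intro f
  obtain ⟨w, hw⟩ := X_sq_dvd_of_mem_cuspIdeal f.2
  obtain ⟨q, hq⟩ : ∃ q : cusp k, w = C (coeff 1 w) * X - (q : k⟦X⟧) :=
    ⟨⟨C (coeff 1 w) * X - w, by simp [mem_cusp]⟩, (sub_sub_cancel _ _).symm⟩
  refine ⟨(⟨⟨X ^ 2 * C (coeff 1 w), X_sq_mul_mem_cusp _⟩, X_sq_mul_mem_cuspIdeal _⟩, q),
    cuspIdeal_ext ?_⟩
  rw [coe_prodToCuspIdeal, hw]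
  change X ^ 2 * C (coeff 1 w) * X - X ^ 2 * (q : k⟦X⟧) = X ^ 2 * w
  nth_rw 2 [hq]
  ring

theorem stab_map_eq {A : Type u} [CommRing A] {X Y : ModuleCat.{u} A} {f g : X ⟶ Y}
    (h : FactorsThroughProjective (f - g)) : (stab A).map f = (stab A).map g :=
  CategoryTheory.Quotient.sound _ h

/-- A projective summand disappears in the stable category. -/
def stabProdIso {A M P : Type u} [CommRing A] [AddCommGroup M] [Module A M] [AddCommGroup P]
    [Module A P] (Z : Type u) [AddCommGroup Z] [Module A Z] [Subsingleton Z]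
    (hP : Module.Projective A P) :
    (stab A).obj (ModuleCat.of A (M × P)) ≅ (stab A).obj (ModuleCat.of A (Z × M)) where
  hom := (stab A).map (ModuleCat.ofHom (LinearMap.inr A Z M ∘ₗ LinearMap.fst A M P))
  inv := (stab A).map (ModuleCat.ofHom (LinearMap.inl A M P ∘ₗ LinearMap.snd A Z M))
  hom_inv_id := by
    refine ((stab A).map_comp _ _).symm.trans (Eq.trans ?_ ((stab A).map_id _))
    refine stab_map_eq ⟨ModuleCat.of A P, ModuleCat.ofHom (LinearMap.snd A M P),
      ModuleCat.ofHom (-LinearMap.inr A M P), hP, ?_⟩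
    refine ModuleCat.hom_ext (LinearMap.ext fun x => ?_)
    change -((0 : M), x.2) = (x.1, (0 : P)) - x
    ext <;> simp
  inv_hom_id := by
    refine ((stab A).map_comp _ _).symm.trans (Eq.trans ?_ ((stab A).map_id _))
    congr 1
    refine ModuleCat.hom_ext (LinearMap.ext fun x => ?_)
    exact Prod.ext (Subsingleton.elim _ _) rfl

/-- Multiplication by `s` is stably nilpotent on `𝔪`: its square factors as `𝔪 ⊂ R → 𝔪`. -/
theorem isNilpotent_stab_cuspIdealMul :
    IsNilpotent (R := End ((stab (cusp k)).obj (cuspIdealModule k)))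
      ((stab (cusp k)).map (X := cuspIdealModule k) (Y := cuspIdealModule k)
        (ModuleCat.ofHom (cuspIdealMul X))) := by
  refine ⟨2, ?_⟩
  rw [pow_two, End.mul_def]
  refine ((stab (cusp k)).map_comp _ _).symm.trans
    ((stab_map_eq ?_).trans ((stab (cusp k)).map_zero _ _))
  refine ⟨ModuleCat.of (cusp k) (cusp k), ModuleCat.ofHom (cuspIdeal k).subtype,
    ModuleCat.ofHom (toCuspIdeal 1), inferInstanceAs (Module.Projective (cusp k) (cusp k)), ?_⟩
  rw [sub_zero]
  refine ModuleCat.hom_ext (LinearMap.ext fun (f : cuspIdeal k) => cuspIdeal_ext ?_)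
  change X ^ 2 * (((f : cusp k) : k⟦X⟧) * 1) = ((f : cusp k) : k⟦X⟧) * X * X
  ring

/-- The triangle comes from the exact sequence `0 → 𝔪 → 𝔪 ⊕ R → 𝔪 → 0`, whose middle term is
stably isomorphic to `0 ⊕ 𝔪`. -/
theorem cusp_hasNilpotentTriangle :
    HasNilpotentTriangle (cusp k) (ModuleCat.of (cusp k) PUnit.{u + 1}) (cuspIdealModule k) := by
  have hP : Module.Projective (cusp k) (cusp k) := inferInstance
  let β := stabProdIso (A := cusp k) (M := cuspIdealModule k) (P := cusp k) PUnit.{u + 1} hP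
  let S : ShortComplex (ModuleCat.{u} (cusp k)) := ShortComplex.mk
    (X₁ := cuspIdealModule k) (X₂ := ModuleCat.of (cusp k) (cuspIdealModule k × cusp k))
    (X₃ := cuspIdealModule k) (ModuleCat.ofHom (cuspIdealToProd k))
    (ModuleCat.ofHom (prodToCuspIdeal k))
    (ModuleCat.hom_ext (exact_cuspIdealToProd k).linearMap_comp_eq_zero)
  let q : cuspIdealModule k ⟶ cuspIdealModule k := ModuleCat.ofHom (cuspIdealMul (-X))
  have hM := isCM_cuspIdealModule k
  have hX₂ : IsCM (ModuleCat.of (cusp k) (cuspIdealModule k × cusp k)) := by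
    have := hM.1
    exact isCM_of_le_free k (LinearMap.prodMap (cuspIdeal k).subtype LinearMap.id)
      (Subtype.val_injective.prodMap Function.injective_id)
  refine ⟨isCM_punit k, hM, cuspIdealModule k, cuspCosyzygy k, 0,
    (stab (cusp k)).map (X := cuspIdealModule k) (Y := cuspIdealModule k)
      (ModuleCat.ofHom (cuspIdealMul X)), β.inv ≫ (stab _).map S.g, (stab _).map q, hM,
    isNilpotent_stab_cuspIdealMul k, S, cuspCosyzygy k,
    ModuleCat.ofHom ((LinearMap.snd _ _ _).prod
      ((cuspIdeal k).subtype ∘ₗ LinearMap.fst (cusp k) (cuspIdeal k) (cusp k))), q,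
    Iso.refl _, β, Iso.refl _, Iso.refl _, ?_, hM, hX₂, hM, ?_, ?_, ?_, ?_, ?_, ?_⟩
  · exact ModuleCat.shortComplex_shortExact _ (exact_cuspIdealToProd k)
      (fun _ _ h => Subtype.ext (congrArg Prod.snd h)) (prodToCuspIdeal_surjective k)
  · rfl
  · refine ModuleCat.hom_ext (LinearMap.ext fun (x : cuspIdeal k × cusp k) => cuspIdeal_ext ?_)
    refine Eq.trans ?_ (coe_sqToCuspIdeal k _).symm
    change ((prodToCuspIdeal k x : cusp k) : k⟦X⟧) * (-X) =
      X ^ 2 * ((x.2 : k⟦X⟧) * X) - X ^ 2 * ((x.1 : cusp k) : k⟦X⟧)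
    rw [coe_prodToCuspIdeal]
    ring
  · exact ⟨𝟙 _, 𝟙 _, 𝟙 _, rfl, rfl, (stab _).map_id _, (stab _).map_id _⟩
  · rw [Limits.zero_comp, zero_add, Iso.refl_hom, Category.id_comp]
    change _ ≫ _ = (stab _).map _ ≫ (stab _).map _
    exact ((stab (cusp k)).map_comp _ _).symm.trans ((stab (cusp k)).map_comp _ _)
  · simp
  · simp

end Triangle

/-! ### Matrix factorizations over quadratic extensions -/

section Tensor

variable (k : Type u) [Field k] {S A : Type u} [CommRing S] [CommRing A] [Algebra S A]
  [Algebra k S] [Algebra k A] [IsScalarTower k S A] {y : A} {c : S} (V : Type u) [CommRing V]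
  [Algebra k V]

variable (S A) in
/-- `A ⊗ V` as an algebra over `S ⊗ V`. -/
abbrev tensorAlgebra : Algebra (S ⊗[k] V) (A ⊗[k] V) :=
  (Algebra.TensorProduct.map (IsScalarTower.toAlgHom k S A) (AlgHom.id k V)).toRingHom.toAlgebra

theorem IsQuadratic.tensor (h : IsQuadratic S A y c) :
    letI := tensorAlgebra k S A V
    IsQuadratic (S ⊗[k] V) (A ⊗[k] V) (y ⊗ₜ 1) (c ⊗ₜ 1) := by
  let := tensorAlgebra k S A V
  refine ⟨?_, ?_⟩
  · change _ = Algebra.TensorProduct.map (IsScalarTower.toAlgHom k S A) (AlgHom.id k V) (c ⊗ₜ 1)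
    rw [Algebra.TensorProduct.tmul_mul_tmul, h.sq]
    simp
  · let e : ((S ⊗[k] V) × (S ⊗[k] V)) ≃ₗ[k] A ⊗[k] V :=
      (TensorProduct.prodLeft k k S S V).symm ≪≫ₗ
        TensorProduct.congr (h.equiv.restrictScalars k) (LinearEquiv.refl k V)
    let i : S ⊗[k] V →ₗ[k] A ⊗[k] V :=
      (Algebra.TensorProduct.map (IsScalarTower.toAlgHom k S A) (AlgHom.id k V)).toLinearMap
    have he : (e : ((S ⊗[k] V) × (S ⊗[k] V)) →ₗ[k] A ⊗[k] V) =
        i.coprod (LinearMap.mulRight k (y ⊗ₜ 1) ∘ₗ i) := by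
      apply LinearMap.prod_ext <;> refine TensorProduct.ext' fun s v => ?_
      · have h0 : (s ⊗ₜ[k] v, (0 : S ⊗[k] V)) = TensorProduct.prodLeft k k S S V ((s, 0) ⊗ₜ v) := by
          simp
        simp [e, i, h0, -TensorProduct.prodLeft_tmul, h.equiv_apply]
      · have h0 : ((0 : S ⊗[k] V), s ⊗ₜ[k] v) = TensorProduct.prodLeft k k S S V ((0, s) ⊗ₜ v) := by
          simp
        simp [e, i, h0, -TensorProduct.prodLeft_tmul, h.equiv_apply]
    convert e.bijective using 1
    funext p
    exact (LinearMap.congr_fun he p).symm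

end Tensor

namespace IsQuadratic

open scoped Matrix

variable {S A : Type u} [CommRing S] [CommRing A] [Algebra S A] {y : A} {c : S}
  (h : IsQuadratic S A y c) {ι : Type} [Fintype ι] [DecidableEq ι] (D : Matrix ι ι S)

/-- The matrix `y + D` over `A`. -/
def factor (_ : IsQuadratic S A y c) (D : Matrix ι ι S) : Matrix ι ι A :=
  Matrix.scalar ι y + D.map (algebraMap S A)

/-- The cokernel of the matrix `y + D`. If `D ^ 2 = c`, then `(y + D, y - D)` is a matrix
factorization of `y ^ 2 - c`. -/
abbrev coker (h : IsQuadratic S A y c) (D : Matrix ι ι S) : Type u :=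
  (ι → A) ⧸ LinearMap.range (h.factor D).mulVecLin

omit [Fintype ι] [DecidableEq ι] in
include h in
theorem exists_coord (v : ι → A) :
    ∃ p q : ι → S, v = algebraMap S A ∘ p + y • (algebraMap S A ∘ q) := by
  choose w hw using fun i => h.bij.2 (v i)
  refine ⟨fun i => (w i).1, fun i => (w i).2, funext fun i => ?_⟩
  rw [← hw i]
  simp [mul_comm]

omit [Fintype ι] [DecidableEq ι] in
include h in
theorem coord_eq {p q p' q' : ι → S} (hpq : algebraMap S A ∘ p + y • (algebraMap S A ∘ q) =
    algebraMap S A ∘ p' + y • (algebraMap S A ∘ q')) : p = p' ∧ q = q' := by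
  have (i : ι) : (p i, q i) = (p' i, q' i) := h.bij.1 <| by
    simpa [mul_comm] using congrFun hpq i
  exact ⟨funext fun i => congrArg Prod.fst (this i), funext fun i => congrArg Prod.snd (this i)⟩

theorem factor_mulVec (p q : ι → S) :
    h.factor D *ᵥ (algebraMap S A ∘ p + y • (algebraMap S A ∘ q)) =
      algebraMap S A ∘ (c • q + D *ᵥ p) + y • (algebraMap S A ∘ (p + D *ᵥ q)) := by
  have e : ∀ v : ι → S, D.map (algebraMap S A) *ᵥ (algebraMap S A ∘ v) =
      algebraMap S A ∘ (D *ᵥ v) := fun v =>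
    funext fun i => (RingHom.map_mulVec (algebraMap S A) D v i).symm
  have e' : ∀ v w : ι → S, algebraMap S A ∘ (v + w) = algebraMap S A ∘ v + algebraMap S A ∘ w :=
    fun v w => funext fun i => map_add _ _ _
  have e'' : algebraMap S A ∘ (c • q) = (y * y) • (algebraMap S A ∘ q) := by
    rw [h.sq]
    exact funext fun i => map_mul _ _ _
  rw [factor, Matrix.add_mulVec, Matrix.mulVec_add, Matrix.mulVec_add, Matrix.mulVec_smul,
    Matrix.mulVec_smul, e, e, e', e', e'']
  simp only [Matrix.scalar_apply, ← Matrix.smul_one_eq_diagonal, Matrix.smul_mulVec,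
    Matrix.one_mulVec, smul_add, smul_smul]
  abel

/-- If `D ^ 2 = c`, then the cokernel of `y + D` is `S ^ ι`, on which `y` acts as `-D`. -/
theorem coker_isCM (hD : D * D = Matrix.scalar ι c) :
    IsCM (ModuleCat.of A (h.coker D)) := by
  let : Module S (h.coker D) := Submodule.Quotient.module' _
  let f : (ι → S) →ₗ[S] h.coker D :=
    ((LinearMap.range (h.factor D).mulVecLin).mkQ.restrictScalars S) ∘ₗ
      LinearMap.compLeft (Algebra.linearMap S A) ι
  have hD' : ∀ q : ι → S, D *ᵥ D *ᵥ q = c • q := fun q => by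
    rw [Matrix.mulVec_mulVec, hD, Matrix.scalar_apply, ← Matrix.smul_one_eq_diagonal,
      Matrix.smul_mulVec, Matrix.one_mulVec]
  have hf : Function.Bijective f := by
    constructor
    · rw [← LinearMap.ker_eq_bot, LinearMap.ker_eq_bot']
      intro r hr
      obtain ⟨v, hv⟩ := (Submodule.Quotient.mk_eq_zero _).1 hr
      obtain ⟨p, q, rfl⟩ := h.exists_coord v
      have h1 := (h.factor_mulVec D p q).symm.trans hv
      have h2 : algebraMap S A ∘ (c • q + D *ᵥ p) + y • (algebraMap S A ∘ (p + D *ᵥ q)) =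
          algebraMap S A ∘ r + y • (algebraMap S A ∘ (0 : ι → S)) := by
        rw [h1]
        ext i
        simp
      obtain ⟨h3, h4⟩ := h.coord_eq h2
      rw [← h3, eq_neg_of_add_eq_zero_left h4, Matrix.mulVec_neg, hD', add_neg_cancel]
    · intro z
      obtain ⟨v, rfl⟩ := Submodule.mkQ_surjective _ z
      obtain ⟨p, q, rfl⟩ := h.exists_coord v
      refine ⟨p - D *ᵥ q, ?_⟩
      refine (Submodule.Quotient.eq _).2
        ⟨algebraMap S A ∘ (-q) + y • (algebraMap S A ∘ (0 : ι → S)), ?_⟩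
      refine (h.factor_mulVec D _ _).trans ?_
      ext i
      simp [Matrix.mulVec_neg]
      ring
  have : Module.Projective S (h.coker D) :=
    Module.Projective.of_equiv (LinearEquiv.ofBijective f hf)
  exact h.isCM (ModuleCat.of A (h.coker D))

theorem extendScalars_map_smul_id {A B : Type u} [CommRing A] [CommRing B] (f : A →+* B)
    (M : ModuleCat.{u} A) (a : A) :
    (ModuleCat.extendScalars f).map (a • 𝟙 M) = f a • 𝟙 ((ModuleCat.extendScalars f).obj M) := by
  refine ModuleCat.ExtendScalars.hom_ext fun m => ?_
  let := f.toAlgebra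
  change (1 : B) ⊗ₜ[A] (a • m) = (f a * 1) ⊗ₜ[A] m
  rw [← TensorProduct.smul_tmul, Algebra.smul_def]
  rfl

/-- If `y + D` becomes von Neumann regular over a ring where `a` is invertible, then its cokernel
becomes projective there. -/
theorem projective_extendScalars_coker {B : Type u} [CommRing B] (f : A →+* B) (N : Matrix ι ι A)
    (a : A) (ha : IsUnit (f a)) (hN : h.factor D * N * h.factor D = a • h.factor D) :
    Projective ((ModuleCat.extendScalars f).obj (ModuleCat.of A (h.coker D))) := by
  let F := ModuleCat.extendScalars f
  let P := ModuleCat.of A (ι → A)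
  have hP : Projective P := (IsProjective.iff_projective (R := A) (ι → A)).1 inferInstance
  have hFP : Projective (F.obj P) :=
    (ModuleCat.extendRestrictScalarsAdj f).map_projective P hP
  -- the section `v ↦ a v - (y + D) N v` of the projection, up to the factor `a`
  let θ : h.coker D →ₗ[A] (ι → A) := Submodule.liftQ _
    (a • LinearMap.id - (h.factor D * N).mulVecLin) <| by
      rintro _ ⟨v, rfl⟩
      rw [LinearMap.mem_ker]
      change a • (h.factor D *ᵥ v) - (h.factor D * N) *ᵥ (h.factor D *ᵥ v) = 0
      rw [Matrix.mulVec_mulVec, hN, Matrix.smul_mulVec, sub_self]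
  have hθ : ∀ z, (LinearMap.range (h.factor D).mulVecLin).mkQ (θ z) = a • z := by
    intro z
    obtain ⟨v, rfl⟩ := Submodule.mkQ_surjective _ z
    refine (Submodule.Quotient.eq _).2 ⟨-(N *ᵥ v), ?_⟩
    change h.factor D *ᵥ (-(N *ᵥ v)) = a • v - (h.factor D * N) *ᵥ v - a • v
    rw [Matrix.mulVec_neg, Matrix.mulVec_mulVec]
    abel
  let π : P ⟶ ModuleCat.of A (h.coker D) :=
    ModuleCat.ofHom (LinearMap.range (h.factor D).mulVecLin).mkQ
  have hθπ : ModuleCat.ofHom θ ≫ π = a • 𝟙 _ := ModuleCat.hom_ext (LinearMap.ext hθ)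
  refine Retract.projective (Y := F.obj P)
    ⟨F.map (ModuleCat.ofHom θ), ((ha.unit⁻¹ : Bˣ) : B) • F.map π, ?_⟩
  rw [Linear.comp_smul, ← F.map_comp, hθπ, extendScalars_map_smul_id, smul_smul, IsUnit.val_inv_mul,
    one_smul]

end IsQuadratic

/-! ### The family degenerating to the maximal ideal -/

section Retraction

variable (k : Type u) [Field k] (R : Type u) [CommRing R] [Algebra k R] {V : Type u} [CommRing V]
  [Algebra k V] (ε : V →ₐ[k] k)

/-- The retraction `R ⊗ V → R` induced by a `k`-valued point of `V`. -/
def tensorRetraction : R ⊗[k] V →ₐ[k] R :=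
  Algebra.TensorProduct.productMap (AlgHom.id k R) ((Algebra.ofId k R).comp ε)

theorem tensorRetraction_tmul (r : R) (v : V) :
    tensorRetraction k R ε (r ⊗ₜ v) = r * algebraMap k R (ε v) := rfl

theorem tensorRetraction_algebraMap (r : R) :
    tensorRetraction k R ε (algebraMap R (R ⊗[k] V) r) = r := by
  rw [Algebra.TensorProduct.algebraMap_apply, tensorRetraction_tmul, map_one, map_one, mul_one]
  rfl

/-- If `V = k ⊕ tV`, then `R ⊗ V = R ⊕ t (R ⊗ V)`. -/
theorem exists_eq_add_smul {t : V} (ht : ∀ v, ε v = 0 → t ∣ v) (a : R ⊗[k] V) :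
    ∃ b, a = algebraMap R _ (tensorRetraction k R ε a) + (1 ⊗ₜ t) * b := by
  induction a with
  | zero => exact ⟨0, by simp⟩
  | add a b ha hb =>
    obtain ⟨a', ha⟩ := ha
    obtain ⟨b', hb⟩ := hb
    refine ⟨a' + b', ?_⟩
    rw [map_add, map_add, mul_add]
    nth_rw 1 [ha, hb]
    ring
  | tmul r v =>
    obtain ⟨w, hw⟩ := ht (v - algebraMap k V (ε v)) (by simp)
    refine ⟨r ⊗ₜ w, ?_⟩
    rw [tensorRetraction_tmul, Algebra.TensorProduct.algebraMap_apply,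
      Algebra.TensorProduct.tmul_mul_tmul, ← hw, one_mul, tmul_sub,
      Algebra.algebraMap_eq_smul_one (R := k) (A := R), mul_smul_comm, mul_one,
      Algebra.algebraMap_self, RingHom.id_apply, smul_tmul, ← Algebra.algebraMap_eq_smul_one,
      add_sub_cancel]

end Retraction

section LocalLine

open Polynomial

variable (k : Type u) [Field k]

/-- The origin, a `k`-valued point of the local line. -/
def localLineEval : LocalLine k →ₐ[k] k :=
  IsLocalization.liftAlgHom (M := (tIdeal k).primeCompl) (f := Polynomial.aeval (0 : k))
    fun p => by
      rw [isUnit_iff_ne_zero]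
      intro h
      refine p.2 (Ideal.mem_span_singleton.2 (X_dvd_iff.2 ?_))
      rw [coeff_zero_eq_aeval_zero]
      simpa using h

/-- The parameter `t` of the local line. -/
def localLineT : LocalLine k := algebraMap k[X] (LocalLine k) X

theorem localLineEval_algebraMap (p : k[X]) :
    localLineEval k (algebraMap k[X] (LocalLine k) p) = aeval (0 : k) p :=
  IsLocalization.lift_eq _ p

theorem localLineT_dvd (v : LocalLine k) (hv : localLineEval k v = 0) : localLineT k ∣ v := by
  obtain ⟨p, s, rfl⟩ := IsLocalization.exists_mk'_eq (tIdeal k).primeCompl v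
  have h1 : localLineEval k (algebraMap k[X] (LocalLine k) p) = 0 := by
    rw [← IsLocalization.mk'_spec (LocalLine k) p s, map_mul, hv, zero_mul]
  rw [localLineEval_algebraMap, ← coeff_zero_eq_aeval_zero] at h1
  obtain ⟨q, rfl⟩ := X_dvd_iff.2 h1
  exact ⟨IsLocalization.mk' _ q s, by rw [localLineT, IsLocalization.mul_mk'_eq_mk'_of_mul]⟩

theorem localLineEval_T : localLineEval k (localLineT k) = 0 := by
  rw [localLineT, localLineEval_algebraMap, aeval_X]

theorem isUnit_algebraMap_localLineT :
    IsUnit (algebraMap (LocalLine k) (FractionRing (LocalLine k)) (localLineT k)) := by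
  have : IsDomain (LocalLine k) := IsLocalization.isDomain_of_atPrime (LocalLine k) (tIdeal k)
  rw [isUnit_iff_ne_zero, Ne, IsFractionRing.to_map_eq_zero_iff]
  intro h
  exact X_ne_zero (IsLocalization.injective (LocalLine k)
    (Ideal.primeCompl_le_nonZeroDivisors (tIdeal k)) (h.trans (map_zero _).symm))

end LocalLine

section Family

/-- The matrix `D` for which `y + D` is the matrix with rows `(y + t³, x - t²)` and
`(x² + t² x + t⁴, y - t³)`. Over the ring of the cusp, the cokernel of `y + D` is isomorphic to
the ideal of the point `(t², t³)`. -/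
def pointMatrix {S : Type u} [CommRing S] (x t : S) : Matrix (Fin 2) (Fin 2) S :=
  !![t ^ 3, x - t ^ 2; x ^ 2 + t ^ 2 * x + t ^ 4, - t ^ 3]

theorem pointMatrix_mul_self {S : Type u} [CommRing S] (x t : S) :
    pointMatrix x t * pointMatrix x t = Matrix.scalar (Fin 2) (x ^ 3) := by
  rw [pointMatrix]
  ext i j
  fin_cases i <;> fin_cases j <;> simp [Matrix.mul_apply, Fin.sum_univ_two] <;> ring

theorem factor_pointMatrix {S A : Type u} [CommRing S] [CommRing A] [Algebra S A] {y : A} {c : S}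
    (h : IsQuadratic S A y c) (x t : S) : h.factor (pointMatrix x t) =
    !![y + algebraMap S A t ^ 3, algebraMap S A x - algebraMap S A t ^ 2;
      algebraMap S A x ^ 2 + algebraMap S A t ^ 2 * algebraMap S A x + algebraMap S A t ^ 4,
      y - algebraMap S A t ^ 3] := by
  ext i j
  fin_cases i <;> fin_cases j <;> simp [IsQuadratic.factor, pointMatrix, sub_eq_add_neg]

/-- The fourth power of `t` is a combination of the entries of `y + D`, and a `2 × 2` matrix `M`
with determinant zero satisfies `M N M = tr (M N) M`. -/
theorem factor_pointMatrix_mul_mul {S A : Type u} [CommRing S] [CommRing A] [Algebra S A] {y : A}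
    (x t : S) (h : IsQuadratic S A y (x ^ 3)) :
    h.factor (pointMatrix x t) *
      !![-algebraMap S A t, 1; -(algebraMap S A x + 2 * algebraMap S A t ^ 2), algebraMap S A t] *
      h.factor (pointMatrix x t) =
    algebraMap S A t ^ 4 • h.factor (pointMatrix x t) := by
  have hy := h.sq
  rw [map_pow] at hy
  rw [factor_pointMatrix]
  generalize algebraMap S A x = x' at hy ⊢
  generalize algebraMap S A t = s
  rw [Matrix.smul_of]
  ext i j
  fin_cases i <;> fin_cases j <;> simp [Matrix.mul_apply, Fin.sum_univ_two]
  · linear_combination (-s) * hy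
  · linear_combination hy
  · linear_combination (-(x' + 2 * s ^ 2)) * hy
  · linear_combination s * hy

variable (k : Type u) [Field k] (V : Type u) [CommRing V] [Algebra k V] (t : V)

attribute [local instance] tensorAlgebra

theorem cusp_tensor_isQuadratic :
    IsQuadratic (CuspBase k ⊗[k] V) (cusp k ⊗[k] V) (cuspY k ⊗ₜ 1) ((cuspBaseX k ⊗ₜ 1) ^ 3) := by
  rw [Algebra.TensorProduct.tmul_pow, one_pow]
  exact (cusp_isQuadratic k).tensor k V

/-- The ideal of the point `(t², t³)` of the cusp, as the cokernel of a matrix. -/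
def pointModule : ModuleCat.{u} (cusp k ⊗[k] V) :=
  ModuleCat.of _ ((cusp_tensor_isQuadratic k V).coker (pointMatrix (cuspBaseX k ⊗ₜ 1) (1 ⊗ₜ t)))

theorem pointModule_isCM : IsCM (A := cusp k ⊗[k] V) (pointModule k V t) :=
  (cusp_tensor_isQuadratic k V).coker_isCM _ (pointMatrix_mul_self _ _)

theorem pointModule_projective_extendScalars {B : Type u} [CommRing B] (f : cusp k ⊗[k] V →+* B)
    (hf : IsUnit (f (1 ⊗ₜ t))) :
    Projective ((ModuleCat.extendScalars (R := cusp k ⊗[k] V) (S := B) f).obj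
      (pointModule k V t)) := by
  refine (cusp_tensor_isQuadratic k V).projective_extendScalars_coker _ f _ _ ?_
    (factor_pointMatrix_mul_mul _ _ _)
  have : algebraMap (CuspBase k ⊗[k] V) (cusp k ⊗[k] V) (1 ⊗ₜ t) = 1 ⊗ₜ t := by
    change algebraMap (CuspBase k) (cusp k) 1 ⊗ₜ t = 1 ⊗ₜ t
    rw [map_one]
  rw [this, map_pow]
  exact hf.pow 4

end Family

section SpecialFibre

open scoped Matrix

/-- Reduction of the cokernel of a matrix `M` modulo the kernel `(t)` of a retraction `ρ`. -/
theorem exists_bijective_quotSMulTop_coker {A R N ι : Type*} [CommRing A] [CommRing R]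
    [AddCommGroup N] [Module R N] [Fintype ι] (ρ : A →+* R) (hρ : Function.Surjective ρ) (t : A)
    (ht : ρ t = 0) (hker : ∀ a, ρ a = 0 → t ∣ a) (M : Matrix ι ι A) (Ψ : (ι → R) →ₗ[R] N)
    (hΨ : Function.Surjective Ψ) (hM : LinearMap.ker Ψ = LinearMap.range (M.map ρ).mulVecLin) :
    ∃ f : QuotSMulTop t ((ι → A) ⧸ LinearMap.range M.mulVecLin) →ₛₗ[ρ] N,
      Function.Bijective f := by
  let Ψ₀ : (ι → A) →ₛₗ[ρ] N :=
    { toFun := fun v => Ψ (ρ ∘ v)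
      map_add' := fun v w => by
        rw [← map_add]
        congr 1
        ext i
        simp
      map_smul' := fun a v => by
        rw [← map_smul]
        congr 1
        ext i
        simp }
  have hmap : ∀ v : ι → A, ρ ∘ (M *ᵥ v) = M.map ρ *ᵥ (ρ ∘ v) := fun v =>
    funext fun i => RingHom.map_mulVec ρ M v i
  let Ψ₁ : ((ι → A) ⧸ LinearMap.range M.mulVecLin) →ₛₗ[ρ] N := Submodule.liftQ _ Ψ₀ <| by
    rintro _ ⟨v, rfl⟩
    have h : ρ ∘ (M *ᵥ v) ∈ LinearMap.ker Ψ := by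
      rw [hM, hmap]
      exact ⟨_, rfl⟩
    exact h
  let Ψ₂ : QuotSMulTop t ((ι → A) ⧸ LinearMap.range M.mulVecLin) →ₛₗ[ρ] N :=
    Submodule.liftQ _ Ψ₁ <| by
      rintro _ ⟨z, -, rfl⟩
      rw [LinearMap.mem_ker]
      refine (Ψ₁.map_smulₛₗ _ z).trans ?_
      rw [ht, zero_smul]
  refine ⟨Ψ₂, ?_, ?_⟩
  · rw [injective_iff_map_eq_zero]
    intro z hz
    obtain ⟨z, rfl⟩ := Submodule.mkQ_surjective _ z
    obtain ⟨v, rfl⟩ := Submodule.mkQ_surjective _ z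
    have h1 : ρ ∘ v ∈ LinearMap.ker Ψ := hz
    rw [hM] at h1
    obtain ⟨w, hw⟩ := h1
    choose w' hw' using fun i => hρ (w i)
    obtain rfl : ρ ∘ w' = w := funext hw'
    have h2 : ∀ i, ρ (v i - (M *ᵥ w') i) = 0 := fun i => by
      have := congrFun ((hmap w').trans hw) i
      rw [map_sub, sub_eq_zero]
      exact this.symm
    choose u hu using fun i => hker _ (h2 i)
    refine (Submodule.Quotient.mk_eq_zero _).2 ⟨Submodule.Quotient.mk u, trivial, ?_⟩
    refine (Submodule.Quotient.eq _).2 ⟨-w', ?_⟩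
    ext i
    have := hu i
    simp only [map_neg, Matrix.mulVecLin_apply, Pi.neg_apply, Pi.sub_apply, Pi.smul_apply,
      smul_eq_mul]
    rw [← this]
    ring
  · intro n
    obtain ⟨w, rfl⟩ := hΨ n
    choose w' hw' using fun i => hρ (w i)
    obtain rfl : ρ ∘ w' = w := funext hw'
    exact ⟨Submodule.Quotient.mk (Submodule.Quotient.mk w'), rfl⟩

variable (k : Type u) [Field k]

/-- The generators `s³` and `-s²` of `𝔪` have the matrix of relations `y + D`, taken at `t = 0`. -/
theorem ker_sqToCuspIdeal_comp_finTwoArrow :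
    LinearMap.ker (sqToCuspIdeal k ∘ₗ (LinearEquiv.finTwoArrow (cusp k) (cusp k)).toLinearMap) =
      LinearMap.range (!![cuspY k, cuspX k; cuspX k ^ 2, cuspY k] : Matrix _ _ _).mulVecLin := by
  ext v
  constructor
  · intro hv
    obtain ⟨g, hg⟩ := (exact_cuspIdealToSq k _).1 hv
    obtain ⟨p, q, hpq⟩ := Ideal.mem_span_pair.1 g.2
    have h0 : (g : cusp k) = v 0 := congrArg Prod.fst hg
    have h1 : ((g : cusp k) : PowerSeries k) * PowerSeries.X = (v 1 : PowerSeries k) :=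
      congrArg (fun x => (x.2 : PowerSeries k)) hg
    refine ⟨![q, p], ?_⟩
    refine funext fun i => ?_
    fin_cases i
    · simp [← h0, ← hpq]
      ring
    · rw [← hpq] at h1
      refine Subtype.ext ?_
      simp [← h1, cuspX, cuspY]
      ring
  · rintro ⟨w, rfl⟩
    refine cuspIdeal_ext ((coe_sqToCuspIdeal k _).trans ?_)
    simp [cuspX, cuspY]
    ring

end SpecialFibre

section StableDegeneration

variable {k : Type u} [Field k] {V : Type u} [CommRing V] [Algebra k V] {t : V}

theorem nonempty_specialFibre_iso {R N : Type u} [CommRing R] [Algebra k R] [AddCommGroup N]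
    [Module R N] (t : V) (Q : ModuleCat.{u} (R ⊗[k] V)) (ρ : R ⊗[k] V →+* R)
    (hρ : ∀ r : R, ρ (algebraMap R (R ⊗[k] V) r) = r)
    (f : QuotSMulTop ((1 : R) ⊗ₜ[k] t) Q →ₛₗ[ρ] N) (hf : Function.Bijective f) :
    Nonempty (specialFibre k R V t Q ≅ ModuleCat.of R N) := by
  let g : specialFibre k R V t Q →ₗ[R] N :=
    { toFun := f
      map_add' := f.map_add
      map_smul' := fun r z => by
        refine (f.map_smulₛₗ (algebraMap R (R ⊗[k] V) r) z).trans ?_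
        rw [hρ, RingHom.id_apply] }
  exact ⟨(LinearEquiv.ofBijective g hf).toModuleIso⟩

/-- At `t = 0` the ideal of the point `(t², t³)` specializes to `𝔪`. -/
theorem nonempty_specialFibre_pointModule_iso (ε : V →ₐ[k] k) (hε : ∀ v, ε v = 0 → t ∣ v)
    (ht : ε t = 0) :
    Nonempty (specialFibre k (cusp k) V t (pointModule k V t) ≅ cuspIdealModule k) := by
  let := tensorAlgebra k (CuspBase k) (cusp k) V
  let ρ : cusp k ⊗[k] V →+* cusp k := (tensorRetraction k (cusp k) ε).toRingHom
  have hρ : ∀ r : cusp k, ρ (algebraMap (cusp k) (cusp k ⊗[k] V) r) = r :=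
    tensorRetraction_algebraMap k (cusp k) ε
  have hρ1 : ∀ r : cusp k, ρ (r ⊗ₜ 1) = r := hρ
  have ht0 : ρ (1 ⊗ₜ t) = 0 := by
    refine (tensorRetraction_tmul k (cusp k) ε 1 t).trans ?_
    rw [ht, map_zero, mul_zero]
  have h1 : algebraMap (CuspBase k ⊗[k] V) (cusp k ⊗[k] V) (1 ⊗ₜ t) = 1 ⊗ₜ t := by
    change algebraMap (CuspBase k) (cusp k) 1 ⊗ₜ t = 1 ⊗ₜ t
    rw [map_one]
  have h2 : algebraMap (CuspBase k ⊗[k] V) (cusp k ⊗[k] V) (cuspBaseX k ⊗ₜ 1) = cuspX k ⊗ₜ 1 := by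
    rw [← algebraMap_cuspBaseX]
    rfl
  let Ψ : (Fin 2 → cusp k) →ₗ[cusp k] cuspIdeal k :=
    sqToCuspIdeal k ∘ₗ (LinearEquiv.finTwoArrow (cusp k) (cusp k)).toLinearMap
  have hΨ : Function.Surjective Ψ :=
    (sqToCuspIdeal_surjective k).comp (LinearEquiv.finTwoArrow (cusp k) (cusp k)).surjective
  obtain ⟨f, hf⟩ := exists_bijective_quotSMulTop_coker (N := cuspIdeal k) ρ
    (fun r => ⟨_, hρ r⟩) (1 ⊗ₜ t) ht0
    (fun a ha => by
      obtain ⟨b, hb⟩ := exists_eq_add_smul k (cusp k) ε hε a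
      refine ⟨b, hb.trans ?_⟩
      rw [show tensorRetraction k (cusp k) ε a = 0 from ha, map_zero, zero_add])
    ((cusp_tensor_isQuadratic k V).factor (pointMatrix (cuspBaseX k ⊗ₜ 1) (1 ⊗ₜ t)))
    Ψ hΨ (by
      refine (ker_sqToCuspIdeal_comp_finTwoArrow k).trans ?_
      rw [factor_pointMatrix, h1, h2]
      congr 2
      generalize (1 : cusp k) ⊗ₜ[k] t = s at ht0
      ext i j
      fin_cases i <;> fin_cases j <;> simp [ht0, hρ1])
  exact nonempty_specialFibre_iso t (pointModule k V t) ρ hρ f hf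

/-- Projective modules are zero objects of the stable category. -/
theorem nonempty_stab_iso_of_projective {A : Type u} [CommRing A] (X Y : ModuleCat.{u} A)
    (hX : Projective X) (hY : Projective Y) : Nonempty ((stab A).obj X ≅ (stab A).obj Y) := by
  have key : ∀ X : ModuleCat.{u} A, Projective X → (stab A).map (0 : X ⟶ X) = 𝟙 _ := fun X hX =>
    (stab_map_eq ⟨X, -𝟙 X, 𝟙 X, ModuleCat.projective_of_module_projective X, by simp⟩).trans
      ((stab A).map_id X)
  refine ⟨⟨(stab A).map 0, (stab A).map 0, ?_, ?_⟩⟩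
  · exact ((stab A).map_comp _ _).symm.trans ((congrArg _ Limits.zero_comp).trans (key X hX))
  · exact ((stab A).map_comp _ _).symm.trans ((congrArg _ Limits.zero_comp).trans (key Y hY))

/-- Outside `t = 0` the point `(t², t³)` is a smooth point of the cusp and its ideal is projective,
while at `t = 0` it is the singular point. -/
theorem cusp_stablyDegenerates (k : Type u) [Field k] :
    StablyDegenerates k (cusp k) (ModuleCat.of (cusp k) PUnit.{u + 1}) (cuspIdealModule k) := by
  refine ⟨isCM_punit k, isCM_cuspIdealModule k,
    pointModule k (LocalLine k) (localLineT k), pointModule_isCM k _ _, ?_, ?_⟩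
  · refine nonempty_stab_iso_of_projective _ _
      (pointModule_projective_extendScalars k _ _ _ ?_) ?_
    · exact (isUnit_algebraMap_localLineT k).map
        (Algebra.TensorProduct.includeRight :
          FractionRing (LocalLine k) →ₐ[k] cusp k ⊗[k] FractionRing (LocalLine k))
    · exact (ModuleCat.extendRestrictScalarsAdj _).map_projective _
        ((IsProjective.iff_projective (R := cusp k) PUnit.{u + 1}).1 inferInstance)
  · obtain ⟨e⟩ := nonempty_specialFibre_pointModule_iso (t := localLineT k) (localLineEval k)
      (localLineT_dvd k) (localLineEval_T k)
    exact ⟨(stab (cusp k)).mapIso e⟩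

end StableDegeneration

/-! ### Expansion of a family in powers of the parameter -/

section Expansion

open PowerSeries

variable {R A : Type*} [CommRing R] [CommRing A] [Algebra R A]

/-- If `A = R ⊕ tA` with `t` regular, then expansion in powers of `t` maps `A` to `R⟦X⟧`. -/
theorem exists_expansion (ρ : A →ₐ[R] R) {t : A} (ht : ∀ a, t * a = 0 → a = 0) (hρt : ρ t = 0)
    (hρ : ∀ a, ∃ b, a = algebraMap R A (ρ a) + t * b) :
    ∃ Φ : A →+* R⟦X⟧, (∀ r, Φ (algebraMap R A r) = C r) ∧ Φ t = X := by
  choose d hd using hρ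
  have hcancel : ∀ a b, t * a = t * b → a = b := fun a b h =>
    sub_eq_zero.1 (ht _ (by rw [mul_sub, h, sub_self]))
  have hadd : ∀ a b, d (a + b) = d a + d b := fun a b => hcancel _ _ <| by
    have h := hd (a + b)
    rw [map_add, map_add] at h
    linear_combination -h + hd a + hd b
  have hsmul : ∀ r a, d (algebraMap R A r * a) = algebraMap R A r * d a := fun r a =>
    hcancel _ _ <| by
      have h := hd (algebraMap R A r * a)
      rw [map_mul, map_mul, AlgHom.commutes, Algebra.algebraMap_self, RingHom.id_apply] at h
      linear_combination -h + algebraMap R A r * hd a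
  have hone : d 1 = 0 := ht _ <| by
    have h := hd 1
    rw [map_one, map_one] at h
    linear_combination -h
  have htd : ∀ a, d (t * a) = a := fun a => hcancel _ _ <| by
    have h := hd (t * a)
    rw [map_mul, hρt, zero_mul, map_zero, zero_add] at h
    exact h.symm
  let φ : A → R⟦X⟧ := fun a => mk fun n => ρ (d^[n] a)
  have hstep : ∀ a, φ a = C (ρ a) + X * φ (d a) := by
    intro a
    ext n
    cases n with
    | zero => simp [φ]
    | succ n => simp [φ, coeff_succ_X_mul]
  have hφadd : ∀ a b, φ (a + b) = φ a + φ b := by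
    have : ∀ n a b, d^[n] (a + b) = d^[n] a + d^[n] b := by
      intro n
      induction n with
      | zero => intro a b; rfl
      | succ n ih => intro a b; rw [Function.iterate_succ_apply, hadd, ih]; rfl
    intro a b
    ext n
    simp [φ, this]
  have hφone : φ 1 = 1 := by
    have h0 : φ 0 = 0 := by simpa using hφadd 0 0
    rw [hstep, hone, h0, map_one, map_one, mul_zero, add_zero]
  have hφsmul : ∀ r a, φ (algebraMap R A r * a) = C r * φ a := by
    have : ∀ n r a, d^[n] (algebraMap R A r * a) = algebraMap R A r * d^[n] a := by
      intro n
      induction n with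
      | zero => intro r a; rfl
      | succ n ih => intro r a; rw [Function.iterate_succ_apply, hsmul, ih]; rfl
    intro r a
    ext n
    simp [φ, this]
  have hφt : ∀ a, φ (t * a) = X * φ a := fun a => by
    rw [hstep, htd, map_mul, hρt, zero_mul, map_zero, zero_add]
  have hφmul : ∀ a b, φ (a * b) = φ a * φ b := by
    intro a b
    ext n
    induction n generalizing a with
    | zero => simp [φ]
    | succ n ih =>
      have h1 : φ (a * b) = C (ρ a) * φ b + X * φ (d a * b) := by
        nth_rw 1 [hd a]
        rw [add_mul, hφadd, hφsmul, mul_assoc, hφt]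
      rw [h1, hstep a, add_mul, map_add, map_add, mul_assoc, coeff_succ_X_mul, coeff_succ_X_mul, ih]
  refine ⟨⟨⟨⟨φ, hφone⟩, hφmul⟩, ?_, hφadd⟩, fun r => ?_, ?_⟩
  · simpa using hφadd 0 0
  · have := hφsmul r 1
    rwa [mul_one, hφone, mul_one] at this
  · have := hφt 1
    rwa [mul_one, hφone, mul_one] at this

/-- A functional on `Q / tQ` lifts to a functional on `Q` with values in `R⟦X⟧`, whose coefficients
are found one after the other by extending functionals from `tQ` to `Q`. -/
theorem exists_lift_expansion {Q : Type*} [AddCommGroup Q] [Module A Q] [Module R Q]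
    [IsScalarTower R A Q] (ρ : A →ₐ[R] R) {t : A} (hρ : ∀ a, ∃ b, a = algebraMap R A (ρ a) + t * b)
    (Φ : A →+* R⟦X⟧) (hΦ : ∀ r, Φ (algebraMap R A r) = C r) (hΦt : Φ t = X)
    (hext : ∀ φ : Q →ₗ[R] R, ∃ ψ : Q →ₗ[R] R, ∀ q, ψ (t • q) = φ q)
    (h₀ : Q →ₗ[R] R) (h₀t : ∀ q, h₀ (t • q) = 0) :
    ∃ h : Q →ₛₗ[Φ] R⟦X⟧, ∀ q, constantCoeff (h q) = h₀ q := by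
  choose next hnext using hext
  let c : ℕ → Q →ₗ[R] R := fun n => next^[n] h₀
  let h : Q → R⟦X⟧ := fun q => mk fun n => c n q
  have hc : ∀ n q, c (n + 1) (t • q) = c n q := fun n q => by
    simp only [c, Function.iterate_succ_apply', hnext]
  have hadd : ∀ q q', h (q + q') = h q + h q' := fun q q' => by ext n; simp [h]
  have hsmul : ∀ (r : R) q, h (algebraMap R A r • q) = C r * h q := fun r q => by
    ext n
    simp [h]
  have ht : ∀ q, h (t • q) = X * h q := fun q => by
    ext n
    cases n with
    | zero => simpa [h, c] using h₀t q
    | succ n => simp [h, coeff_succ_X_mul, hc]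
  have hmul : ∀ a q, h (a • q) = Φ a * h q := by
    intro a q
    ext n
    have key : ∀ a b, a = algebraMap R A (ρ a) + t * b →
        h (a • q) - Φ a * h q = X * (h (b • q) - Φ b * h q) := by
      intro a b hab
      have e1 : h (a • q) = C (ρ a) * h q + X * h (b • q) := by
        conv_lhs => rw [hab]
        rw [add_smul, hadd, hsmul, mul_smul, ht]
      have e2 : Φ a = C (ρ a) + X * Φ b := by
        conv_lhs => rw [hab]
        rw [map_add, map_mul, hΦ, hΦt]
      rw [e1, e2]
      ring
    rw [← sub_eq_zero, ← map_sub]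
    induction n generalizing a with
    | zero =>
      obtain ⟨b, hb⟩ := hρ a
      rw [key a b hb, coeff_zero_X_mul]
    | succ n ih =>
      obtain ⟨b, hb⟩ := hρ a
      rw [key a b hb, coeff_succ_X_mul, ih]
  refine ⟨⟨⟨h, hadd⟩, hmul⟩, fun q => ?_⟩
  change constantCoeff (h q) = _
  simp [h, c]

end Expansion

/-! ### Families with free generic fibre -/

section Core

open PowerSeries

open scoped Matrix

/-- If `δ` divides `p` and `r` up to a power of `X`, and the constant coefficients of `p` and `r`
have no common divisors but units, then `δ` is a power of `X` up to a unit. -/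
theorem exists_eq_X_pow_mul_of_dvd {R : Type*} [CommRing R] [IsDomain R] {δ p r : R⟦X⟧}
    (hδ : δ ≠ 0) {L : ℕ} (hp : δ ∣ X ^ L * p) (hr : δ ∣ X ^ L * r)
    (hpr : ∀ d : R, d ∣ constantCoeff p → d ∣ constantCoeff r → IsUnit d) :
    ∃ (i : ℕ) (ε : R⟦X⟧), IsUnit ε ∧ δ = X ^ i * ε := by
  have hX : Prime (X : R⟦X⟧) := X_prime
  have hndvd : ¬ X ∣ divXPowOrder δ := by
    rw [X_dvd_iff, constantCoeff_divXPowOrder_eq_zero_iff]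
    exact hδ
  have key : ∀ q, δ ∣ X ^ L * q → divXPowOrder δ ∣ q := by
    intro q hq
    obtain ⟨e, he⟩ := (Dvd.intro_left _ (X_pow_order_mul_divXPowOrder (f := δ))).trans hq
    obtain ⟨e', rfl⟩ := hX.pow_dvd_of_dvd_mul_left L hndvd ⟨q, he.symm⟩
    refine ⟨e', mul_left_cancel₀ (pow_ne_zero L X_ne_zero) ?_⟩
    rw [he]
    ring
  refine ⟨_, divXPowOrder δ, ?_, X_pow_order_mul_divXPowOrder.symm⟩
  rw [isUnit_iff_constantCoeff]
  exact hpr _ (map_dvd _ (key p hp)) (map_dvd _ (key r hr))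

variable {R A Q ι κ : Type*} [CommRing R] [CommRing A] [AddCommGroup Q] [Module A Q]
  {Φ : A →+* R⟦X⟧} {t : A}

/-- Vectors over `A` are dense among the vectors over `R⟦X⟧`. -/
theorem exists_eq_map_add_X_pow_mul [Algebra R A] (hΦ : ∀ r, Φ (algebraMap R A r) = C r)
    (hΦt : Φ t = X) (l : ℕ) (c : κ → R⟦X⟧) :
    ∃ (a : κ → A) (c' : κ → R⟦X⟧), c = (fun j => Φ (a j)) + (X ^ l : R⟦X⟧) • c' := by
  induction l with
  | zero => exact ⟨0, c, by ext1 j; simp⟩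
  | succ l ih =>
    obtain ⟨a, c', rfl⟩ := ih
    choose c'' hc using fun j => X_dvd_iff.2
      (show constantCoeff (c' j - C (constantCoeff (c' j))) = 0 by simp)
    refine ⟨fun j => a j + t ^ l * algebraMap R A (constantCoeff (c' j)), c'', ?_⟩
    ext1 j
    have := hc j
    simp only [Pi.add_apply, Pi.smul_apply, smul_eq_mul, map_add, map_mul, map_pow, hΦ, hΦt]
    linear_combination X ^ l * this

/-- If `Q / tQ` embeds in `R^ι`, then an element of `Q` is divisible by `t ^ l` as soon as its
expansion is divisible by `X ^ l`. -/
theorem exists_eq_pow_smul (hΦt : Φ t = X) (H : Q →ₛₗ[Φ] (ι → R⟦X⟧))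
    (hH : ∀ q, (∀ i, constantCoeff (H q i) = 0) → ∃ q', q = t • q') (l : ℕ) {q : Q}
    {z : ι → R⟦X⟧} (hq : H q = (X ^ l : R⟦X⟧) • z) : ∃ q', q = t ^ l • q' := by
  induction l generalizing q with
  | zero => exact ⟨q, by simp⟩
  | succ l ih =>
    obtain ⟨q', rfl⟩ := hH q fun i => by simp [hq]
    obtain ⟨q'', rfl⟩ := ih (q := q') <| by
      rw [map_smulₛₗ, hΦt, pow_succ', mul_smul] at hq
      ext1 i
      exact X_mul_cancel (congrFun hq i)
    exact ⟨q'', by rw [smul_smul, pow_succ']⟩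

variable [Fintype κ] [DecidableEq κ]

/-- The matrix over `R⟦X⟧` of an `A`-linear map from a free module to `Q`, followed by the
expansion `H`. -/
def expansionMatrix (H : Q →ₛₗ[Φ] (ι → R⟦X⟧)) (g : (κ → A) →ₗ[A] Q) : Matrix ι κ R⟦X⟧ :=
  Matrix.of fun i j => H (g (Pi.single j 1)) i

open scoped Matrix in
theorem expansionMatrix_mulVec (H : Q →ₛₗ[Φ] (ι → R⟦X⟧)) (g : (κ → A) →ₗ[A] Q) (a : κ → A) :
    expansionMatrix H g *ᵥ (fun j => Φ (a j)) = H (g a) := by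
  conv_rhs => rw [pi_eq_sum_univ' a]
  ext1 i
  simp [expansionMatrix, Matrix.mulVec, dotProduct, map_sum, mul_comm]

open scoped Matrix in
/-- If `g` is injective and `t ^ l` annihilates its cokernel, then the matrix of `g` is injective
over `R⟦X⟧`: modulo `X ^ (l + 1)`, a vector in its kernel is the expansion of a vector `a` over `A`
for which `g a` is divisible by `t ^ (l + 1)`, and then `a` is divisible by `t`. -/
theorem expansionMatrix_mulVec_injective [Algebra R A]
    (hΦ : ∀ r, Φ (algebraMap R A r) = C r) (hΦt : Φ t = X) (H : Q →ₛₗ[Φ] (ι → R⟦X⟧))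
    (hH : ∀ q, (∀ i, constantCoeff (H q i) = 0) → ∃ q', q = t • q') (g : (κ → A) →ₗ[A] Q)
    (hg : Function.Injective g) {l : ℕ} (hl : ∀ q, ∃ a, t ^ l • q = g a) :
    Function.Injective (expansionMatrix H g).mulVec := by
  set G := expansionMatrix H g with hG
  have hdvd : ∀ c, G *ᵥ c = 0 → ∃ c', c = (X : R⟦X⟧) • c' := by
    intro c hc
    obtain ⟨a, c', rfl⟩ := exists_eq_map_add_X_pow_mul hΦ hΦt (l + 1) c
    rw [Matrix.mulVec_add, Matrix.mulVec_smul, hG, expansionMatrix_mulVec,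
      add_eq_zero_iff_eq_neg, ← smul_neg] at hc
    obtain ⟨q, hq⟩ := exists_eq_pow_smul hΦt H hH _ hc
    obtain ⟨a', ha'⟩ := hl q
    rw [pow_succ', mul_smul, ha', ← map_smul] at hq
    obtain rfl := hg hq
    refine ⟨(fun j => Φ (a' j)) + (X ^ l : R⟦X⟧) • c', ?_⟩
    ext1 j
    simp only [Pi.add_apply, Pi.smul_apply, smul_eq_mul, map_mul, hΦt]
    ring
  have hpow : ∀ (n : ℕ) c, G *ᵥ c = 0 → ∀ j, X ^ n ∣ c j := by
    intro n
    induction n with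
    | zero => simp
    | succ n ih =>
      intro c hc j
      obtain ⟨c', rfl⟩ := hdvd c hc
      rw [pow_succ']
      refine mul_dvd_mul_left X (ih c' ?_ j)
      rw [Matrix.mulVec_smul] at hc
      ext1 i
      exact X_mul_cancel ((congrFun hc i).trans (mul_zero (X : R⟦X⟧)).symm)
  rw [← Matrix.coe_mulVecLin, ← LinearMap.ker_eq_bot, LinearMap.ker_eq_bot']
  intro c hc
  ext j n
  exact X_pow_dvd_iff.1 (hpow (n + 1) c hc j) n (Nat.lt_succ_self n)

open scoped Matrix in
/-- Let `Q` be a family with free generic fibre, and let `Q → R⟦X⟧^ι` reduce modulo `t` to an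
injection of `Q / tQ` into `R^ι`. If two of the minors of this injection are coprime, then
the determinant of the expansion of a generic basis of `Q` is a power of `X` up to a unit, and the
injection is onto. -/
theorem exists_constantCoeff_eq_of_generically_free [IsDomain R] [Algebra R A] [Fintype ι]
    [DecidableEq ι] (hΦ : ∀ r, Φ (algebraMap R A r) = C r) (hΦt : Φ t = X)
    (H : Q →ₛₗ[Φ] (ι → R⟦X⟧))
    (hH : ∀ q, (∀ i, constantCoeff (H q i) = 0) → ∃ q', q = t • q') (g : (κ → A) →ₗ[A] Q)
    (hg : Function.Injective g) {l : ℕ} (hl : ∀ q, ∃ a, t ^ l • q = g a) (u w : ι → Q)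
    (hu : (Matrix.of fun i j => constantCoeff (H (u j) i)).det ≠ 0)
    (huw : ∀ d, d ∣ (Matrix.of fun i j => constantCoeff (H (u j) i)).det →
      d ∣ (Matrix.of fun i j => constantCoeff (H (w j) i)).det → IsUnit d) (v : ι → R) :
    ∃ q, ∀ i, constantCoeff (H q i) = v i := by
  set G := expansionMatrix H g with hG
  have hGinj : Function.Injective G.mulVec :=
    expansionMatrix_mulVec_injective hΦ hΦt H hH g hg hl
  have hfac : ∀ p : ι → Q, ∃ Y : Matrix κ ι R⟦X⟧,
      (X ^ l : R⟦X⟧) • (Matrix.of fun i j => H (p j) i) = G * Y := by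
    intro p
    choose a ha using fun j => hl (p j)
    refine ⟨Matrix.of fun k j => Φ (a j k), ?_⟩
    ext1 i j
    have h := congrFun (congrArg H (ha j)) i
    rw [map_smulₛₗ, map_pow, hΦt, ← expansionMatrix_mulVec] at h
    exact h
  have hdet : ∀ p : ι → Q, constantCoeff (Matrix.of fun i j => H (p j) i).det =
      (Matrix.of fun i j => constantCoeff (H (p j) i)).det := fun p => RingHom.map_det _ _
  -- the vectors `u` show that `κ` and `ι` have the same cardinality
  obtain ⟨Y, hY⟩ := hfac u
  have hYinj : Function.Injective Y.mulVec := by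
    rw [← Matrix.coe_mulVecLin, ← LinearMap.ker_eq_bot, LinearMap.ker_eq_bot']
    intro c hc
    refine Matrix.eq_zero_of_mulVec_eq_zero (M := Matrix.of fun i j => H (u j) i) ?_ ?_
    · intro h
      rw [← hdet, h, map_zero] at hu
      exact hu rfl
    · refine smul_right_injective _ (pow_ne_zero l (X_ne_zero (R := R))) ?_
      change _ • _ = _ • (0 : ι → R⟦X⟧)
      rw [← Matrix.smul_mulVec, hY, ← Matrix.mulVec_mulVec, ← Matrix.mulVecLin_apply Y, hc,
        Matrix.mulVec_zero, smul_zero]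
  have hcard : Fintype.card κ = Fintype.card ι :=
    (card_le_of_injective _ (f := G.mulVecLin) hGinj).antisymm
      (card_le_of_injective _ (f := Y.mulVecLin) hYinj)
  let e : κ ≃ ι := Fintype.equivOfCardEq hcard
  set G' : Matrix ι ι R⟦X⟧ := G.submatrix id e.symm with hG'
  have hG'v : ∀ c, G' *ᵥ c = G *ᵥ (c ∘ e) := fun c => by
    rw [hG', Matrix.submatrix_mulVec_equiv, Function.comp_id, Equiv.symm_symm]
  have hdvd : ∀ p : ι → Q,
      G'.det ∣ X ^ (l * Fintype.card ι) * (Matrix.of fun i j => H (p j) i).det := by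
    intro p
    obtain ⟨Y, hY⟩ := hfac p
    rw [pow_mul, ← Matrix.det_smul, hY]
    refine ⟨(Y.submatrix e.symm id).det, ?_⟩
    rw [← Matrix.det_mul, hG', Matrix.submatrix_mul_equiv, Matrix.submatrix_id_id]
  have hG'0 : G'.det ≠ 0 := by
    intro h
    obtain ⟨c, hc0, hc⟩ := Matrix.exists_mulVec_eq_zero_iff.2 h
    rw [hG'v] at hc
    have h0 := hGinj (hc.trans (Matrix.mulVec_zero G).symm)
    refine hc0 (funext fun i => ?_)
    simpa using congrFun h0 (e.symm i)
  obtain ⟨i, ε, ⟨ε, rfl⟩, hε⟩ := exists_eq_X_pow_mul_of_dvd hG'0 (hdvd u) (hdvd w) fun d h1 h2 =>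
    huw d (by rwa [hdet] at h1) (by rwa [hdet] at h2)
  -- By Cramer's rule `det G • v` is in the image of `G`, hence so is `X ^ i • v`.
  have hv : G *ᵥ (((ε⁻¹ : (R⟦X⟧)ˣ) • (G'.adjugate *ᵥ (C ∘ v))) ∘ e) =
      (X ^ i : R⟦X⟧) • (C ∘ v : ι → R⟦X⟧) := by
    rw [← hG'v, Matrix.mulVec_smul, Matrix.mulVec_mulVec, Matrix.mul_adjugate, hε,
      Matrix.smul_mulVec, Matrix.one_mulVec, mul_comm, mul_smul, ← Units.smul_def,
      inv_smul_smul]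
  obtain ⟨a, c', hc⟩ := exists_eq_map_add_X_pow_mul hΦ hΦt (i + 1)
    (((ε⁻¹ : (R⟦X⟧)ˣ) • (G'.adjugate *ᵥ (C ∘ v))) ∘ e)
  rw [hc, Matrix.mulVec_add, Matrix.mulVec_smul, hG, expansionMatrix_mulVec, pow_succ, mul_smul,
    ← eq_sub_iff_add_eq, ← smul_sub] at hv
  obtain ⟨q, hq⟩ := exists_eq_pow_smul hΦt H hH _ hv
  rw [hq, map_smulₛₗ, map_pow, hΦt] at hv
  refine ⟨q, fun j => ?_⟩
  have h := mul_left_cancel₀ (pow_ne_zero i X_ne_zero) (congrFun hv j)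
  rw [h]
  simp

end Core

/-! ### Generic bases of a family -/

section Generic

/-- If `Q` and `F` have the same localization away from `s`, then a multiple of a generic
isomorphism is an embedding of `F` in `Q` with cokernel annihilated by a power of `s`. -/
theorem exists_injective_of_isLocalizedModule {A Q F F' : Type*} [CommRing A] [AddCommGroup Q]
    [Module A Q] [Module.Finite A Q] [AddCommGroup F] [Module A F] [Module.FinitePresentation A F]
    [AddCommGroup F'] [Module A F'] {s : A} (hs : ∀ x : F, s • x = 0 → x = 0) (f : F →ₗ[A] F')
    [IsLocalizedModule (Submonoid.powers s) f] (p : Q →ₗ[A] F')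
    [IsLocalizedModule (Submonoid.powers s) p] :
    ∃ (g : F →ₗ[A] Q) (l : ℕ), Function.Injective g ∧ ∀ q, ∃ x, s ^ l • q = g x := by
  obtain ⟨g, ⟨_, n, rfl⟩, hg⟩ :=
    Module.FinitePresentation.exists_lift_of_isLocalizedModule (Submonoid.powers s) p f
  replace hg : ∀ x, p (g x) = s ^ n • f x := fun x => LinearMap.congr_fun hg x
  have hs' : ∀ (n : ℕ) (x : F), s ^ n • x = 0 → x = 0 := by
    intro n
    induction n with
    | zero => intro x hx; simpa using hx
    | succ n ih =>
      intro x hx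
      rw [pow_succ, mul_smul] at hx
      exact hs x (ih _ hx)
  have hex : ∀ q, ∃ l, s ^ l • q ∈ LinearMap.range g := by
    intro q
    obtain ⟨⟨x, _, i, rfl⟩, hx⟩ := IsLocalizedModule.surj (Submonoid.powers s) f (p q)
    replace hx : s ^ i • p q = f x := hx
    have h : p (s ^ (n + i) • q) = p (g x) := by
      rw [hg, ← hx, map_smul, smul_smul, pow_add]
    obtain ⟨⟨_, j, rfl⟩, hj⟩ := IsLocalizedModule.exists_of_eq (S := Submonoid.powers s) h
    replace hj : s ^ j • s ^ (n + i) • q = s ^ j • g x := hj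
    exact ⟨j + (n + i), s ^ j • x, by rw [map_smul, ← hj, smul_smul, ← pow_add]⟩
  obtain ⟨T, hT⟩ := Module.Finite.fg_top (R := A) (M := Q)
  choose l hl using hex
  refine ⟨g, T.sup l, ?_, fun q => ?_⟩
  · rw [injective_iff_map_eq_zero]
    intro x hx
    have h := hg x
    rw [hx, map_zero, ← map_smul] at h
    obtain ⟨⟨_, j, rfl⟩, hj⟩ := IsLocalizedModule.exists_of_eq (S := Submonoid.powers s)
      (h.symm.trans (map_zero f).symm)
    exact hs' n _ (hs' j _ (hj.trans (smul_zero _)))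
  · have hle : Submodule.span A (T : Set Q) ≤
        (LinearMap.range g).comap (LinearMap.lsmul A Q (s ^ T.sup l)) := by
      rw [Submodule.span_le]
      intro w hw
      have h : s ^ T.sup l • w = s ^ (T.sup l - l w) • s ^ l w • w := by
        rw [smul_smul, ← pow_add, Nat.sub_add_cancel (Finset.le_sup hw)]
      change s ^ T.sup l • w ∈ LinearMap.range g
      rw [h]
      exact Submodule.smul_mem _ _ (hl w)
    rw [hT] at hle
    obtain ⟨x, hx⟩ := hle (Submodule.mem_top (x := q))
    exact ⟨x, hx.symm⟩

variable {A B : Type u} [CommRing A] [CommRing B] (f : A →+* B)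

theorem nonempty_extendScalars_pi_iso (ι : Type) [Finite ι] :
    Nonempty ((ModuleCat.extendScalars f).obj (ModuleCat.of A (ι → A)) ≅
      ModuleCat.of B (ι → B)) := by
  classical
  have := Fintype.ofFinite ι
  let := f.toAlgebra
  exact ⟨(TensorProduct.piScalarRight A B B ι).toModuleIso⟩

theorem exists_injective_of_extendScalars_iso {s : A}
    (hf : @IsLocalization.Away A _ s B _ f.toAlgebra) (hs : ∀ a, s * a = 0 → a = 0)
    (Q : ModuleCat.{u} A) [Module.Finite A Q] (ι : Type) [Finite ι]
    (e : (ModuleCat.extendScalars f).obj Q ≅ ModuleCat.of B (ι → B)) :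
    ∃ (g : (ι → A) →ₗ[A] Q) (l : ℕ), Function.Injective g ∧ ∀ q, ∃ x, s ^ l • q = g x := by
  let := f.toAlgebra
  let e' : B ⊗[A] Q ≃ₗ[B] (ι → B) := e.toLinearEquiv
  let p : Q →ₗ[A] (ι → B) := (e'.restrictScalars A).toLinearMap ∘ₗ TensorProduct.mk A B Q 1
  have hp : IsLocalizedModule (Submonoid.powers s) p := inferInstance
  exact exists_injective_of_isLocalizedModule
    (fun x hx => funext fun i => hs _ (congrFun hx i))
    (LinearMap.pi fun i : ι => Algebra.linearMap A B ∘ₗ LinearMap.proj i) p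

variable (k : Type u) [Field k] (R : Type u) [CommRing R] [Algebra k R]

theorem familyMap_isLocalization {V : Type u} [CommRing V] [Algebra k V] (t : V) :
    @IsLocalization.Away (R ⊗[k] V) _ (1 ⊗ₜ t) (R ⊗[k] Localization.Away t) _
      (familyMap k R V (Localization.Away t)).toAlgebra := by
  let : Algebra (R ⊗[k] V) (R ⊗[k] Localization.Away t) :=
    (familyMap k R V (Localization.Away t)).toAlgebra
  have : IsScalarTower R (R ⊗[k] V) (R ⊗[k] Localization.Away t) :=
    .of_algebraMap_eq fun r => by simp [RingHom.algebraMap_toAlgebra, familyMap]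
  have := IsLocalization.tensorProduct_tensorProduct_right k R (Submonoid.powers t)
    (Localization.Away t) (by ext; simp [RingHom.algebraMap_toAlgebra, familyMap])
  rwa [Submonoid.map_powers] at this

end Generic

section Degeneration

open Abelian

/-- Let `N ⊆ R^ι` have two coprime minors and `Ext¹(N, R) = 0`. If a family with special fibre `N`
is generically free, then `N = R^ι`: the vanishing of `Ext¹` extends the embedding of `N` to a map
from the family to `R⟦X⟧^ι`. -/
theorem surjective_of_generically_free {R A Q N : Type u} [CommRing R] [IsDomain R] [CommRing A]
    [Algebra R A] (ρ : A →ₐ[R] R) {t : A} (ht : ∀ a, t * a = 0 → a = 0) (hρt : ρ t = 0)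
    (hρ : ∀ a, ∃ b, a = algebraMap R A (ρ a) + t * b) [AddCommGroup Q] [Module A Q] [Module R Q]
    [IsScalarTower R A Q] (htQ : ∀ q : Q, t • q = 0 → q = 0) [AddCommGroup N] [Module R N]
    (p : Q →ₗ[R] N) (hp : Function.Surjective p) (hpt : ∀ q, p q = 0 ↔ ∃ q', q = t • q')
    (hN : Subsingleton (Ext (ModuleCat.of R N) (ModuleCat.of R R) 1))
    {κ : Type*} [Fintype κ] (g : (κ → A) →ₗ[A] Q) {l : ℕ} (hg : Function.Injective g)
    (hl : ∀ q, ∃ a, t ^ l • q = g a) {ι : Type*} [Fintype ι] [DecidableEq ι]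
    (ν : N →ₗ[R] (ι → R)) (hν : Function.Injective ν) (u w : ι → N)
    (hu : (Matrix.of fun i j => ν (u j) i).det ≠ 0)
    (huw : ∀ d, d ∣ (Matrix.of fun i j => ν (u j) i).det →
      d ∣ (Matrix.of fun i j => ν (w j) i).det → IsUnit d) : Function.Surjective ν := by
  classical
  have hp0 : ∀ q, p (t • q) = 0 := fun q => (hpt _).2 ⟨q, rfl⟩
  let f : Q →ₗ[R] Q :=
    { toFun := fun q => t • q
      map_add' := smul_add t
      map_smul' := fun r q => smul_comm t r q }
  let S : ShortComplex (ModuleCat.{u} R) :=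
    ShortComplex.mk (ModuleCat.ofHom f) (ModuleCat.ofHom p) (by ext q; exact hp0 q)
  have hmono : Mono S.f := (ModuleCat.mono_iff_injective _).2 ((injective_iff_map_eq_zero f).2 htQ)
  have hepi : Epi S.g := (ModuleCat.epi_iff_surjective _).2 hp
  have hexact : S.Exact := (ShortComplex.ShortExact.moduleCat_exact_iff_function_exact S).2 <| by
    intro q
    refine (hpt q).trans ⟨?_, ?_⟩
    · rintro ⟨q', rfl⟩
      exact ⟨q', rfl⟩
    · rintro ⟨q', rfl⟩
      exact ⟨q', rfl⟩
  have hS : S.ShortExact := ⟨hexact⟩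
  have hext : ∀ φ : Q →ₗ[R] R, ∃ ψ : Q →ₗ[R] R, ∀ q, ψ (t • q) = φ q := fun φ => by
    obtain ⟨ψ, hψ⟩ := exists_extension_of_subsingleton_ext hS _ hN (ModuleCat.ofHom φ)
    exact ⟨ψ.hom, fun q => LinearMap.congr_fun (congrArg ModuleCat.Hom.hom hψ) q⟩
  obtain ⟨Φ, hΦ, hΦt⟩ := exists_expansion ρ ht hρt hρ
  choose h hh using fun i => exists_lift_expansion ρ hρ Φ hΦ hΦt hext
    (LinearMap.proj i ∘ₗ ν ∘ₗ p) fun q => by simp [hp0]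
  let H : Q →ₛₗ[Φ] (ι → PowerSeries R) :=
    { toFun := fun q i => h i q
      map_add' := fun q q' => funext fun i => map_add (h i) q q'
      map_smul' := fun a q => funext fun i => map_smulₛₗ (h i) a q }
  have hH : ∀ q i, PowerSeries.constantCoeff (H q i) = ν (p q) i := fun q i => hh i q
  choose u' hu' using fun j => hp (u j)
  choose w' hw' using fun j => hp (w j)
  obtain rfl : (fun j => p (u' j)) = u := funext hu'
  obtain rfl : (fun j => p (w' j)) = w := funext hw'
  intro v
  obtain ⟨q, hq⟩ := exists_constantCoeff_eq_of_generically_free hΦ hΦt H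
    (fun q hq => (hpt q).1 (hν (by
      ext1 i
      rw [← hH, hq, map_zero, Pi.zero_apply]))) g hg hl u' w'
    (by simpa only [hH] using hu) (by simpa only [hH] using huw) v
  exact ⟨p q, funext fun i => by rw [← hH, hq]⟩

variable (k : Type u) [Field k] (R : Type u) [CommRing R] [Algebra k R]

theorem tmul_mul_eq_zero {V : Type u} [CommRing V] [Algebra k V] [IsDomain V] {t : V} (ht : t ≠ 0)
    (a : R ⊗[k] V) (ha : (1 ⊗ₜ t) * a = 0) : a = 0 := by
  have h := Module.Flat.lTensor_preserves_injective_linearMap (M := R) (LinearMap.mulLeft k t)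
    (mul_right_injective₀ ht)
  refine (injective_iff_map_eq_zero _).1 h a (Eq.trans ?_ ha)
  clear ha
  induction a with
  | zero => simp
  | add a b ha hb => rw [map_add, ha, hb, mul_add]
  | tmul r v => simp

/-- If `R^m` degenerates to a submodule `N` of `R^ι` with two coprime minors and `Ext¹(N, R) = 0`,
then `N = R^ι`. -/
theorem surjective_of_degenerates [IsDomain R] {m : ℕ} {N : ModuleCat.{u} R}
    (h : Degenerates k R (ModuleCat.of R (Fin m → R)) N)
    (hN : Subsingleton (Ext N (ModuleCat.of R R) 1)) {ι : Type*} [Fintype ι] [DecidableEq ι]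
    (ν : N →ₗ[R] (ι → R)) (hν : Function.Injective ν) (u w : ι → N)
    (hu : (Matrix.of fun i j => ν (u j) i).det ≠ 0)
    (huw : ∀ d, d ∣ (Matrix.of fun i j => ν (u j) i).det →
      d ∣ (Matrix.of fun i j => ν (w j) i).det → IsUnit d) : Function.Surjective ν := by
  obtain ⟨V, _, _, _, _, t, Q, ht, hk, hfin, hflat, ⟨e⟩, ⟨e'⟩⟩ := h
  let ε : V →ₐ[k] k := (AlgEquiv.ofBijective (Algebra.ofId k (V ⧸ Ideal.span {t}))
    hk).symm.toAlgHom.comp (Ideal.Quotient.mkₐ k (Ideal.span {t}))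
  have hε : ∀ v, ε v = 0 ↔ t ∣ v := fun v => by
    rw [← Ideal.mem_span_singleton, ← Ideal.Quotient.eq_zero_iff_mem]
    exact EmbeddingLike.map_eq_zero_iff
      (f := (AlgEquiv.ofBijective (Algebra.ofId k (V ⧸ Ideal.span {t})) hk).symm)
  have htA := tmul_mul_eq_zero k R ht.ne_zero
  have htQ : ∀ q : Q, (1 : R) ⊗ₜ[k] t • q = 0 → q = 0 := by
    intro q hq
    have := hflat
    exact Module.Flat.isSMulRegular_of_nonZeroDivisors (M := overBase k R V Q)
      (mem_nonZeroDivisors_of_ne_zero ht.ne_zero) (hq.trans (smul_zero ((1 : R) ⊗ₜ[k] t)).symm)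
  obtain ⟨e₁⟩ := nonempty_extendScalars_pi_iso (algebraMap R (R ⊗[k] Localization.Away t)) (Fin m)
  obtain ⟨g, l, hg, hl⟩ := exists_injective_of_extendScalars_iso _
    (familyMap_isLocalization k R t) htA Q (Fin m) (e' ≪≫ e₁)
  let : Module R Q := Module.compHom Q (algebraMap R (R ⊗[k] V))
  have : IsScalarTower R (R ⊗[k] V) Q := .of_algebraMap_smul fun _ _ => rfl
  let e₂ := e.toLinearEquiv
  let p : Q →ₗ[R] N :=
    { toFun := fun q => e₂ (Submodule.Quotient.mk q)
      map_add' := fun q q' => e₂.map_add (Submodule.Quotient.mk q) (Submodule.Quotient.mk q')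
      map_smul' := fun r q => e₂.map_smul r (Submodule.Quotient.mk q) }
  let ρ : R ⊗[k] V →ₐ[R] R :=
    { tensorRetraction k R ε with commutes' := tensorRetraction_algebraMap k R ε }
  refine surjective_of_generically_free ρ htA ?_
    (exists_eq_add_smul k R ε fun v => (hε v).1) htQ p ?_ ?_ hN g hg hl ν hν u w hu huw
  · refine (tensorRetraction_tmul k R ε 1 t).trans ?_
    rw [(hε t).2 dvd_rfl, map_zero, mul_zero]
  · intro y
    obtain ⟨q, hq⟩ := Submodule.mkQ_surjective _ (e₂.symm y)
    exact ⟨q, (congrArg e₂ hq).trans (e₂.apply_symm_apply y)⟩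
  · intro q
    refine e₂.map_eq_zero_iff.trans ((Submodule.Quotient.mk_eq_zero _).trans ?_)
    rw [Submodule.mem_smul_pointwise_iff_exists]
    simp [eq_comm]

end Degeneration

section CuspDegeneration

variable (k : Type u) [Field k]

/-- The generators `s²` and `s³` of `𝔪` have no common divisors in the cusp. -/
theorem isUnit_of_dvd_cuspX_cuspY {d : cusp k} (hx : d ∣ cuspX k) (hy : d ∣ cuspY k) :
    IsUnit d := by
  rw [isUnit_cusp_iff]
  intro hd
  obtain ⟨w, hw⟩ := X_sq_dvd_of_mem_cuspIdeal (mem_cuspIdeal.2 hd)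
  obtain ⟨e, he⟩ := hx
  obtain ⟨f, hf⟩ := hy
  have h1 : (PowerSeries.X ^ 2 : PowerSeries k) = (d : PowerSeries k) * (e : PowerSeries k) :=
    congrArg Subtype.val he
  have h2 : (PowerSeries.X ^ 3 : PowerSeries k) = (d : PowerSeries k) * (f : PowerSeries k) :=
    congrArg Subtype.val hf
  have hX : (PowerSeries.X ^ 2 : PowerSeries k) ≠ 0 := pow_ne_zero _ PowerSeries.X_ne_zero
  have h3 : w * (e : PowerSeries k) = 1 := mul_left_cancel₀ hX (by
    rw [← mul_assoc, ← hw, ← h1, mul_one])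
  have h4 : (f : PowerSeries k) = PowerSeries.X * (e : PowerSeries k) := by
    have h5 : w * (f : PowerSeries k) = PowerSeries.X := mul_left_cancel₀ hX (by
      rw [← mul_assoc, ← hw, ← h2, pow_succ])
    linear_combination (-(f : PowerSeries k)) * h3 + (e : PowerSeries k) * h5
  have h5 := (mem_cusp k _).1 f.2
  rw [h4, PowerSeries.coeff_succ_X_mul, PowerSeries.coeff_zero_eq_constantCoeff_apply] at h5
  have h6 := congrArg PowerSeries.constantCoeff h3
  rw [map_mul, h5, mul_zero, map_one] at h6
  exact zero_ne_one h6

/-- Embed `R^n ⊕ 𝔪` in `R^n ⊕ R`. The minors given by the bases of `R^n`, completed by `s²` and by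
`s³`, are `s²` and `s³`. -/
theorem not_degenerates_free_prod_cuspIdealModule (m n : ℕ) :
    ¬ Degenerates k (cusp k) (ModuleCat.of (cusp k) (Fin m → cusp k))
      (ModuleCat.of (cusp k) ((Fin n → cusp k) × cuspIdealModule k)) := by
  intro h
  let ν : ((Fin n → cusp k) × cuspIdeal k) →ₗ[cusp k] (Fin n ⊕ Unit → cusp k) :=
    { toFun := fun z => Sum.elim z.1 fun _ => z.2
      map_add' := fun z z' => by ext1 (i | i) <;> rfl
      map_smul' := fun r z => by ext1 (i | i) <;> rfl }
  let u : cuspIdeal k → Fin n ⊕ Unit → (Fin n → cusp k) × cuspIdeal k := fun g =>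
    Sum.elim (fun j => (Pi.single j 1, 0)) fun _ => (0, g)
  have hu : ∀ g, (Matrix.of fun i j => ν (u g j) i).det = g := by
    intro g
    have : (Matrix.of fun i j => ν (u g j) i) =
        Matrix.diagonal (Sum.elim (fun _ => 1) fun _ => (g : cusp k)) := by
      ext1 i j
      rcases i with i | i <;> rcases j with j | j <;>
        simp [ν, u, Matrix.diagonal_apply, Pi.single_apply]
    rw [this, Matrix.det_diagonal, Fintype.prod_sum_type]
    simp
  have hν : Function.Injective ν := by
    intro z z' hz
    refine Prod.ext (funext fun i => congrFun hz (.inl i)) (Subtype.ext (congrFun hz (.inr ())))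
  let x : cuspIdeal k := ⟨cuspX k, Ideal.subset_span (by simp)⟩
  let y : cuspIdeal k := ⟨cuspY k, Ideal.subset_span (by simp)⟩
  obtain ⟨z, hz⟩ := surjective_of_degenerates k (cusp k) h
    ((isCM_free_prod_cuspIdealModule k (Fin n)).2 1 one_pos) ν hν (u x) (u y)
    (fun h => pow_ne_zero 2 (PowerSeries.X_ne_zero (R := k))
      (congrArg Subtype.val ((hu x).symm.trans h)))
    (fun d hx hy => isUnit_of_dvd_cuspX_cuspY k (hx.trans (hu x).dvd) (hy.trans (hu y).dvd)) 1
  refine (Ideal.ne_top_iff_one _).1 (cuspIdeal_ne_top k) ?_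
  have h1 : ∀ z, ν z = 1 → (1 : cusp k) ∈ cuspIdeal k := fun z hz => by
    have h2 : (z.2 : cusp k) = 1 := congrFun hz (.inr ())
    exact h2 ▸ z.2.2
  exact h1 z hz

theorem not_degeneratesUpToFree_cuspIdealModule :
    ¬ DegeneratesUpToFree k (cusp k) (ModuleCat.of (cusp k) PUnit.{u + 1}) (cuspIdealModule k) := by
  rintro ⟨m, n, V, _, _, _, _, t, Q, ht, hk, hfin, hflat, he, ⟨e⟩⟩
  have e' : ModuleCat.of (cusp k) ((Fin m → cusp k) × PUnit.{u + 1}) ≅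
      ModuleCat.of (cusp k) (Fin m → cusp k) := LinearEquiv.prodUnique.toModuleIso
  exact not_degenerates_free_prod_cuspIdealModule k m n ⟨V, _, ‹_›, ‹_›, _, t, Q, ht, hk, hfin,
    hflat, he, ⟨e ≪≫ (ModuleCat.extendScalars _).mapIso e'⟩⟩

end CuspDegeneration

end

theorem mainTheorem8 (k : Type u) [Field k] :
    -- no direct sum of copies of `R` degenerates to any `R^n ⊕ 𝔪`
    (∀ m n : ℕ, ¬ Degenerates k (cusp k) (ModuleCat.of (cusp k) (Fin m → cusp k))
      (ModuleCat.of (cusp k) ((Fin n → cusp k) × cuspIdealModule k))) ∧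
    -- the cusp is a Gorenstein local `k`-algebra of dimension one, with maximal ideal `𝔪` and
    -- residue field `k`
    IsGorensteinLocal (cusp k) ∧ ringKrullDim (cusp k) = 1 ∧ (cuspIdeal k).IsMaximal ∧
    Function.Bijective (algebraMap k (cusp k ⧸ cuspIdeal k)) ∧
    -- there is a triangle `Z → 0 ⊕ Z → 𝔪 → Z[1]` with nilpotent `Z → Z`, and `0` stably
    -- degenerates to `𝔪`, but `R^m ⊕ 0` never degenerates to `R^n ⊕ 𝔪`
    HasNilpotentTriangle (cusp k) (ModuleCat.of (cusp k) PUnit.{u + 1})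
      (cuspIdealModule k) ∧
    StablyDegenerates k (cusp k) (ModuleCat.of (cusp k) PUnit.{u + 1})
      (cuspIdealModule k) ∧
    ¬ DegeneratesUpToFree k (cusp k) (ModuleCat.of (cusp k) PUnit.{u + 1})
      (cuspIdealModule k) :=
  ⟨not_degenerates_free_prod_cuspIdealModule k, cusp_isGorensteinLocal k, cusp_ringKrullDim k,
    cuspIdeal_isMaximal k, cusp_residue_bijective k, cusp_hasNilpotentTriangle k,
    cusp_stablyDegenerates k, not_degeneratesUpToFree_cuspIdealModule k⟩
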